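/- For $n\ge 0$ let $S_n$ be the symmetric group, whose elements are written $w=w_1\cdots w_n$ with $w_i=w(i)$, and put $w_0=0$. Let $\mathrm{Peak}(w)=\{\,i : 1\le i\le n-1,\ w_{i-1}<w_i>w_{i+1}\}$ be the set of peaks and $\overset{\circ}{\mathrm{Peak}}(w)=\{\,i : 2\le i\le n-1,\ w_{i-1}<w_i>w_{i+1}\}$ the set of interior peaks of $w$. Let $\mathcal F_n$ be the collection of all subsets of $\{1,\dots,n-1\}$ that contain no two consecutive integers, and let $\overset{\circ}{\mathcal F}_n=\{F\in\mathcal F_n : 1\notin F\}$. In the group algebra $\mathbb Q S_n$ put \[ P_F=\sum_{\mathrm{Peak}(w)=F} w\quad (F\in\mathcal F_n),\qquad \overset{\circ}{P}_F=\sum_{\overset{\circ}{\mathrm{Peak}}(w)=F} w\quad (F\in\overset{\circ}{\mathcal F}_n), \] and let $\mathcal P_n$ and $\overset{\circ}{\mathcal P}_n$ be the $\mathbb Q$-linear spans of $\{P_F\}_{F\in\mathcal F_n}$ and of $\{\overset{\circ}{P}_F\}_{F\in\overset{\circ}{\mathcal F}_n}$, respectively. **Theorem.** For every $n\ge 0$,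 $\mathcal P_n$ is a unital subalgebra of $\mathbb Q S_n$ (the peak algebra), and $\overset{\circ}{\mathcal P}_n$ is contained in $\mathcal P_n$ and is a two-sided ideal of $\mathcal P_n$. Moreover, for $n\ge 2$, the linear map $\pi:\mathcal P_n\to\mathcal P_{n-2}$ given for $F\in\mathcal F_n$ by \[ \pi(P_F)=\begin{cases} P_{F-2} & \text{if } 1\notin F \text{ and } 2\notin F,\\ -P_{(F\setminus\{1\})-2} & \text{if } 1\in F,\\ 0 & \text{if } 2\in F,\end{cases} \] where $G-2=\{i-2 : i\in G\}$, is a well-defined surjective homomorphism of unital $\mathbb Q$-algebras, and it induces an isomorphism of $\mathbb Q$-algebras \[ \mathcal P_n/\overset{\circ}{\mathcal P}_n\;\cong\;\mathcal P_{n-2}. \] -/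

import Mathlib

/-- The one-line notation of a permutation, in the usual numbering: `letter w i = w_i ∈ {1, …, n}`
for `1 ≤ i ≤ n`, and `letter w 0 = 0`, which is the convention `w_0 = 0`. (The value `0` at
positions beyond `n` is never used.) -/
def letter {n : ℕ} (w : Equiv.Perm (Fin n)) (i : ℕ) : ℕ :=
  if h : 1 ≤ i ∧ i ≤ n then (w ⟨i - 1, by omega⟩ : ℕ) + 1 else 0

/-- The set of peaks of `w`: the `i ∈ {1, …, n - 1}` with `w_{i-1} < w_i > w_{i+1}`, where `w_0 = 0`.
Here `Finset.Ico 1 n` is `{1, …, n - 1}`. -/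
def peakSet {n : ℕ} (w : Equiv.Perm (Fin n)) : Finset ℕ :=
  {i ∈ Finset.Ico 1 n | letter w (i - 1) < letter w i ∧ letter w (i + 1) < letter w i}

/-- The set of interior peaks of `w`: the `i ∈ {2, …, n - 1}` with `w_{i-1} < w_i > w_{i+1}`. -/
def interiorPeakSet {n : ℕ} (w : Equiv.Perm (Fin n)) : Finset ℕ :=
  {i ∈ Finset.Ico 2 n | letter w (i - 1) < letter w i ∧ letter w (i + 1) < letter w i}

/-- The collection of all `F ⊆ {1, …, n - 1}` containing no two consecutive integers. -/
def fibSets (n : ℕ) : Finset (Finset ℕ) :=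
  {F ∈ (Finset.Ico 1 n).powerset | ∀ i ∈ F, i + 1 ∉ F}

/-- The members of `fibSets n` that do not contain `1`. -/
def interiorFibSets (n : ℕ) : Finset (Finset ℕ) :=
  {F ∈ fibSets n | 1 ∉ F}

/-- The rational group algebra of the symmetric group on `n` letters; permutations multiply by
composition. -/
abbrev SymGroupAlgebra (n : ℕ) : Type :=
  MonoidAlgebra ℚ (Equiv.Perm (Fin n))

/-- `P_F`, the sum of all permutations with peak set `F`. -/
noncomputable def peakSum (n : ℕ) (F : Finset ℕ) : SymGroupAlgebra n :=
  ∑ w : Equiv.Perm (Fin n) with peakSet w = F, MonoidAlgebra.of ℚ (Equiv.Perm (Fin n)) w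

/-- `P°_F`, the sum of all permutations with interior peak set `F`. -/
noncomputable def interiorPeakSum (n : ℕ) (F : Finset ℕ) : SymGroupAlgebra n :=
  ∑ w : Equiv.Perm (Fin n) with interiorPeakSet w = F, MonoidAlgebra.of ℚ (Equiv.Perm (Fin n)) w

/-- The linear span of the `P_F`: the underlying space of the peak algebra. -/
noncomputable def peakSpace (n : ℕ) : Submodule ℚ (SymGroupAlgebra n) :=
  Submodule.span ℚ (peakSum n '' (fibSets n : Set (Finset ℕ)))

/-- The linear span of the `P°_F`: the underlying space of the peak ideal. -/
noncomputable def interiorPeakSpace (n : ℕ) : Submodule ℚ (SymGroupAlgebra n) :=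
  Submodule.span ℚ (interiorPeakSum n '' (interiorFibSets n : Set (Finset ℕ)))

/-- The shifted set `F - 2 = {i - 2 | i ∈ F}`; it is used only for sets all of whose elements are
at least `3`. -/
def shiftTwo (F : Finset ℕ) : Finset ℕ :=
  F.image (fun i => i - 2)

/-- The value at `P_F`, for `F ∈ fibSets (n + 2)`, of the linear map from the peak algebra of
`n + 2` letters to that of `n` letters: `-P_{(F \ {1}) - 2}` if `1 ∈ F`, `0` if `2 ∈ F`, and
`P_{F - 2}` if neither `1` nor `2` is in `F` (`1` and `2` are never both in `F`). -/
noncomputable def peakProjValue (n : ℕ) (F : Finset ℕ) : SymGroupAlgebra n :=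
  if 1 ∈ F then -peakSum n (shiftTwo (F.erase 1))
  else if 2 ∈ F then 0
  else peakSum n (shiftTwo F)

/-!
The proof follows the idea that the peak algebra is the image of the descent algebra of the
hyperoctahedral group under forgetting signs, but it replaces the descent algebra by sums of sorting
permutations of signed vectors, for which products need not be computed.

Let `K` be a linearly ordered abelian group. A vector `x : Fin n → K` has a sorting permutation
`signedSort x`, which lists the indices `i` by increasing `|(x i, i + 1)|`, the absolute value being
taken in the lexicographic product `K ×ₗ ℤ`. Sorting by pairs `(x i, x' i)` amounts to sorting by
`x'` and then sorting a copy of `x` with coordinates permuted and some signs changed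
(`signedSort_toLex`). Hence, for sets `S` closed under permutations and sign changes of the
coordinates, the sum `sortSum S` of the sorting permutations turns the lexicographic product of sets
into the (reversed) product of the group algebra (`sortSum_lexProduct`).

On the other hand, `sortSum S` is determined by the weakly increasing nonnegative members `m` of
`S` (`sortSum_eq`): if `J` is the set of `j ∈ {0, …, n - 1}` with `m_j < m_{j+1}`, where `m_0 = 0`,
then `m` contributes `2 ^ #J` times the sum of all `P_F` with `F ⊆ J ∪ (J + 1)`. For, along a
permutation `w`, each `j ∉ J` forces one sign: that of `m_{j+1}` if `w_j < w_{j+1}`, and that of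
`m_j` otherwise; the demands are in conflict exactly at the peaks of `w` outside `J ∪ (J + 1)`.
Taking `S` to be an orbit of the hyperoctahedral group one gets multiples of these sums for all
`J ⊆ {0, …, n - 1}`, and by triangularity they span the peak algebra
(`peakSpace_eq_span_sortSum`). So the span of the `P_F` is closed under multiplication.

The prescribed values of the projection send the sum belonging to `J` to the one belonging to
`J - 2` if `0, 1 ∉ J`, and to `0` otherwise. In terms of invariant sets, this is the passage from
`S` to the set of those members of `S` that vanish in the first two coordinates
(`IsPeakProj.map_sortSum`), which evidently commutes with lexicographic products; so the projection
is multiplicative. Finally `P°_F = P_F + P_{F ∪ {1}}` for `2 ∉ F` and `P°_F = P_F` for `2 ∈ F`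
identify its kernel with the span of the interior peak sums (`IsPeakProj.map_eq_zero_iff`), which is
therefore an ideal. For `n ≤ 1` that span is the whole algebra.
-/

set_option linter.unusedSectionVars false

/-! ### Sorting permutations of signed vectors -/

section SignedSorting

variable {K K' : Type*} [AddCommGroup K] [LinearOrder K] [IsOrderedAddMonoid K]
  [AddCommGroup K'] [LinearOrder K'] [IsOrderedAddMonoid K'] {n : ℕ}

/-- The absolute value of `(y, c)` in the lexicographically ordered group `K ×ₗ ℤ`, for `0 < c`. -/
def signedKey (y : K) (c : ℤ) : K ×ₗ ℤ :=
  toLex (|y|, if y < 0 then -c else c)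

/-- The key `|(x i, i + 1)|` by which `signedSort x` sorts the index `i`. -/
def sortKey (x : Fin n → K) (i : Fin n) : K ×ₗ ℤ :=
  signedKey (x i) ((i : ℤ) + 1)

/-- The permutation listing the indices `i` by increasing `|(x i, i + 1)|`. -/
def signedSort (x : Fin n → K) : Equiv.Perm (Fin n) :=
  Tuple.sort (sortKey x)

theorem signedKey_lt_signedKey {y z : K} {c d : ℤ} :
    signedKey y c < signedKey z d ↔
      |y| < |z| ∨ |y| = |z| ∧ (if y < 0 then -c else c) < (if z < 0 then -d else d) :=
  Prod.Lex.toLex_lt_toLex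

theorem sortKey_injective (x : Fin n → K) : Function.Injective (sortKey x) := by
  intro i j h
  have h2 : (if x i < 0 then -((i : ℤ) + 1) else (i : ℤ) + 1) =
      if x j < 0 then -((j : ℤ) + 1) else (j : ℤ) + 1 :=
    congrArg (fun p => (ofLex p).2) h
  ext
  split_ifs at h2 <;> omega

theorem signedSort_eq_iff (x : Fin n → K) (w : Equiv.Perm (Fin n)) :
    signedSort x = w ↔ StrictMono (sortKey x ∘ w) := by
  have hmono : Monotone (sortKey x ∘ signedSort x) := Tuple.monotone_sort (sortKey x)
  constructor
  · rintro rfl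
    exact hmono.strictMono_of_injective ((sortKey_injective x).comp (signedSort x).injective)
  · intro h
    have := Tuple.unique_monotone hmono h.monotone
    ext1 i
    exact sortKey_injective x (congrFun this i)

theorem strictMono_sortKey_signedSort (x : Fin n → K) :
    StrictMono (sortKey x ∘ signedSort x) :=
  (signedSort_eq_iff x _).1 rfl

theorem signedSort_zero : signedSort (0 : Fin n → K) = 1 := by
  rw [signedSort_eq_iff]
  intro i j h
  have h' : (i : ℕ) < j := h
  simp only [Function.comp, sortKey, signedKey_lt_signedKey, Equiv.Perm.coe_one, id]
  right
  simpa using h'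

theorem abs_toLex (y : K) (y' : K') :
    |(toLex (y, y') : K ×ₗ K')| =
      toLex (|y|, if y = 0 then |y'| else if y < 0 then -y' else y') := by
  have hneg : -(toLex (y, y') : K ×ₗ K') = toLex (-y, -y') := rfl
  have h0 : (0 : K ×ₗ K') = toLex (0, 0) := rfl
  rcases lt_trichotomy y 0 with h | rfl | h
  · have : (toLex (y, y') : K ×ₗ K') < 0 := by
      rw [h0, Prod.Lex.toLex_lt_toLex]; exact Or.inl h
    rw [abs_of_neg this, hneg, abs_of_neg h, if_neg h.ne, if_pos h]
  · rcases lt_or_ge y' 0 with h' | h'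
    · have : (toLex (0, y') : K ×ₗ K') < 0 := by
        rw [h0, Prod.Lex.toLex_lt_toLex]; exact Or.inr ⟨rfl, h'⟩
      rw [abs_of_neg this, hneg, if_pos rfl, abs_of_neg h', neg_zero, abs_zero]
    · have : (0 : K ×ₗ K') ≤ toLex (0, y') := by
        rw [h0, Prod.Lex.toLex_le_toLex]; exact Or.inr ⟨rfl, h'⟩
      rw [abs_of_nonneg this, if_pos rfl, abs_of_nonneg h', abs_zero]
  · have : (0 : K ×ₗ K') < toLex (y, y') := by
      rw [h0, Prod.Lex.toLex_lt_toLex]; exact Or.inl h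
    rw [abs_of_pos this, abs_of_pos h, if_neg h.ne', if_neg h.asymm]

theorem toLex_lt_zero {y : K} {y' : K'} :
    (toLex (y, y') : K ×ₗ K') < 0 ↔ y < 0 ∨ y = 0 ∧ y' < 0 :=
  Prod.Lex.toLex_lt_toLex

/-- Comparing two triples `(y, y', c)` and `(z, z', d)` up to sign amounts to comparing `(±y, a)`
and `(±z, b)` up to sign, where `a` and `b` are the ranks of `(y', c)` and `(z', d)` up to sign, and
the first coordinates absorb the signs of the latter. -/
theorem signedKey_toLex_lt {y z : K} {y' z' : K'} {a b c d : ℤ} (ha : 0 < a) (hb : 0 < b)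
    (hc : 0 < c) (hd : 0 < d)
    (h₁ : a < b → signedKey y' c < signedKey z' d) (h₂ : b < a → signedKey z' d < signedKey y' c)
    (h : signedKey (if y' < 0 then -y else y) a < signedKey (if z' < 0 then -z else z) b) :
    signedKey (toLex (y, y') : K ×ₗ K') c < signedKey (toLex (z, z') : K ×ₗ K') d := by
  rw [signedKey_lt_signedKey, abs_toLex, abs_toLex, Prod.Lex.toLex_lt_toLex, toLex_inj,
    Prod.mk.injEq]
  simp only [toLex_lt_zero]
  rw [signedKey_lt_signedKey] at h h₁ h₂
  have e1 : |if y' < 0 then -y else y| = |y| := by split_ifs <;> simp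
  have e2 : |if z' < 0 then -z else z| = |z| := by split_ifs <;> simp
  rw [e1, e2] at h
  rcases h with h | ⟨h, h'⟩
  · exact Or.inl (Or.inl h)
  · simp only [h, lt_irrefl, false_or, true_and]
    rcases eq_or_ne y 0 with rfl | hy
    · obtain rfl : z = 0 := by simpa using h.symm
      simp only [neg_zero, ite_self, lt_irrefl, if_false, if_true, false_or, true_and] at h' ⊢
      exact h₁ h'
    -- of nonzero first coordinates of equal size only the signs matter, which act on the rest
    · have hz : z ≠ 0 := by rintro rfl; simp_all
      have ey : -y < 0 ↔ ¬ y < 0 := by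
        rw [neg_lt_zero, not_lt]; exact ⟨le_of_lt, fun h => lt_of_le_of_ne h hy.symm⟩
      have ez : -z < 0 ↔ ¬ z < 0 := by
        rw [neg_lt_zero, not_lt]; exact ⟨le_of_lt, fun h => lt_of_le_of_ne h hz.symm⟩
      have f₁ : y' < -z' ↔ z' < -y' := lt_neg
      have f₂ : -y' < z' ↔ -z' < y' := neg_lt
      have f₃ : y' = -z' ↔ z' = -y' := by rw [← neg_eq_iff_eq_neg, eq_comm]
      have f₄ : -y' = z' ↔ -z' = y' := by
        rw [neg_eq_iff_eq_neg, eq_comm]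
      have f₅ : 0 ≤ y' ↔ -y' ≤ 0 := neg_nonpos.symm
      simp only [hy, hz, if_false, false_and, or_false]
      rcases lt_or_ge y' 0 with hy' | hy' <;> rcases lt_or_ge z' 0 with hz' | hz' <;>
        simp only [hy', hz', hy'.not_gt, hz'.not_gt, if_true, if_false, abs_of_neg, abs_of_nonneg,
          neg_lt_neg_iff, neg_inj, ey, ez] at h₁ h₂ h' ⊢ <;>
        by_cases p : y < 0 <;> by_cases q : z < 0 <;>
        simp only [p, q, if_true, if_false, not_true, not_false_iff, neg_lt_neg_iff,
          neg_inj] at h' ⊢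
      all_goals first
        | omega
        | grind

/-- Sorting by the pair `(x, x')` amounts to sorting by `x'`, after which `x` is sorted with its
coordinates moved to the sorted order and with the signs of the coordinates of `x'`. -/
theorem signedSort_toLex (x : Fin n → K) (x' : Fin n → K') :
    signedSort (fun i => (toLex (x i, x' i) : K ×ₗ K')) =
      signedSort x' * signedSort fun i =>
        if x' (signedSort x' i) < 0 then -x (signedSort x' i) else x (signedSort x' i) := by
  set σ := signedSort x' with hσ
  rw [signedSort_eq_iff]
  have hmono : StrictMono (sortKey x' ∘ σ) := strictMono_sortKey_signedSort x'
  intro i j hij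
  set τ := signedSort fun i => if x' (σ i) < 0 then -x (σ i) else x (σ i) with hτ
  have hlt := strictMono_sortKey_signedSort
    (fun i => if x' (σ i) < 0 then -x (σ i) else x (σ i)) hij
  refine signedKey_toLex_lt (a := (τ i : ℤ) + 1) (b := (τ j : ℤ) + 1) (Nat.cast_add_one_pos _)
    (Nat.cast_add_one_pos _) (Nat.cast_add_one_pos _) (Nat.cast_add_one_pos _)
    (fun h => hmono (?_ : τ i < τ j)) (fun h => hmono (?_ : τ j < τ i)) hlt
  · exact Fin.lt_def.2 (by omega)
  · exact Fin.lt_def.2 (by omega)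

end SignedSorting

/-! ### Invariant sets of vectors and their products -/

section SignInvariant

variable {K K' : Type*} [AddCommGroup K] [LinearOrder K] [IsOrderedAddMonoid K]
  [AddCommGroup K'] [LinearOrder K'] [IsOrderedAddMonoid K'] {n : ℕ}

/-- A finite set of vectors is invariant under the hyperoctahedral group: it is closed under
permuting coordinates and changing their signs. -/
def SignInvariant (S : Finset (Fin n → K)) : Prop :=
  ∀ x ∈ S, ∀ (σ : Equiv.Perm (Fin n)) (t : Fin n → K), (∀ i, |t i| = |x (σ i)|) → t ∈ S

/-- The sum in the group algebra of the sorting permutations of the members of `S`. -/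
noncomputable def sortSum (S : Finset (Fin n → K)) : SymGroupAlgebra n :=
  ∑ x ∈ S, MonoidAlgebra.of ℚ (Equiv.Perm (Fin n)) (signedSort x)

theorem sortSum_singleton_zero : sortSum ({0} : Finset (Fin n → K)) = 1 := by
  rw [sortSum, Finset.sum_singleton, signedSort_zero, map_one]

/-- Vectors `(x, x')` with values in the lexicographic product, for `x ∈ S` and `x' ∈ S'`. -/
def lexProduct (S : Finset (Fin n → K)) (S' : Finset (Fin n → K')) : Finset (Fin n → K ×ₗ K') :=
  (S ×ˢ S').map ⟨fun p i => toLex (p.1 i, p.2 i), fun p q h => by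
    ext i
    · exact congrArg (fun y => (ofLex y).1) (congrFun h i)
    · exact congrArg (fun y => (ofLex y).2) (congrFun h i)⟩

theorem mem_lexProduct {S : Finset (Fin n → K)} {S' : Finset (Fin n → K')}
    {y : Fin n → K ×ₗ K'} :
    y ∈ lexProduct S S' ↔ (fun i => (ofLex (y i)).1) ∈ S ∧ (fun i => (ofLex (y i)).2) ∈ S' := by
  rw [lexProduct, Finset.mem_map]
  constructor
  · rintro ⟨p, hp, rfl⟩
    exact Finset.mem_product.1 hp
  · intro h
    exact ⟨(_, _), Finset.mem_product.2 h, rfl⟩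

theorem SignInvariant.lexProduct {S : Finset (Fin n → K)} {S' : Finset (Fin n → K')}
    (hS : SignInvariant S) (hS' : SignInvariant S') : SignInvariant (lexProduct S S') := by
  intro x hx σ t ht
  rw [mem_lexProduct] at hx ⊢
  have key : ∀ i, |(ofLex (t i)).1| = |(ofLex (x (σ i))).1| ∧
      |(ofLex (t i)).2| = |(ofLex (x (σ i))).2| := by
    intro i
    rcases abs_eq_abs.1 (ht i) with h | h
    · rw [h]; exact ⟨rfl, rfl⟩
    · rw [h]; exact ⟨abs_neg _, abs_neg _⟩
  exact ⟨hS _ hx.1 σ _ fun i => (key i).1, hS' _ hx.2 σ _ fun i => (key i).2⟩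

/-- Sorting sums are anti-multiplicative. For fixed `x'`, the signed permutation that `x'` applies
to `x` in `signedSort_toLex` permutes the members of the invariant set `S`. -/
theorem sortSum_lexProduct {S : Finset (Fin n → K)} (hS : SignInvariant S)
    (S' : Finset (Fin n → K')) : sortSum (lexProduct S S') = sortSum S' * sortSum S := by
  rw [sortSum, lexProduct, Finset.sum_map, Finset.sum_product_right, sortSum, sortSum,
    Finset.sum_mul]
  refine Finset.sum_congr rfl fun x' _ => ?_
  rw [Finset.mul_sum]
  set σ := signedSort x' with hσ
  have hg : ∀ (x : Fin n → K) (j : Fin n),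
      |if x' j < 0 then -x j else x j| = |x j| := fun x j => by split_ifs <;> simp
  refine Finset.sum_bij'
    (fun x _ i => if x' (σ i) < 0 then -x (σ i) else x (σ i))
    (fun x _ i => if x' i < 0 then -x (σ.symm i) else x (σ.symm i)) ?_ ?_ ?_ ?_ ?_
  · exact fun x hx => hS x hx σ _ fun i => hg x _
  · exact fun x hx => hS x hx σ.symm _ fun i => by split_ifs <;> simp
  · intro x _
    ext i
    dsimp only
    rw [Equiv.apply_symm_apply]
    split_ifs <;> simp
  · intro x _
    ext i
    dsimp only
    rw [Equiv.symm_apply_apply]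
    split_ifs <;> simp
  · intro x _
    rw [← map_mul]
    exact congrArg _ (signedSort_toLex x x')

/-- The members of `S` whose first two coordinates vanish, with these coordinates dropped. -/
noncomputable def dropTwo (S : Finset (Fin (n + 2) → K)) : Finset (Fin n → K) :=
  S.preimage (fun x => Fin.cons 0 (Fin.cons 0 x : Fin (n + 1) → K))
    (fun _ _ _ _ h => Fin.cons_right_injective _ (Fin.cons_right_injective _ h))

theorem mem_dropTwo {S : Finset (Fin (n + 2) → K)} {x : Fin n → K} :
    x ∈ dropTwo S ↔ (Fin.cons 0 (Fin.cons 0 x : Fin (n + 1) → K) : Fin (n + 2) → K) ∈ S :=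
  Finset.mem_preimage

theorem SignInvariant.dropTwo {S : Finset (Fin (n + 2) → K)} (hS : SignInvariant S) :
    SignInvariant (dropTwo S) := by
  intro x hx σ t ht
  rw [mem_dropTwo] at hx ⊢
  refine hS _ hx (Equiv.Perm.decomposeFin.symm (0, Equiv.Perm.decomposeFin.symm (0, σ))) _ ?_
  intro i
  refine Fin.cases ?_ (fun i => Fin.cases ?_ (fun i => ?_) i) i
  · simp
  · simp
  · simp [ht]

theorem dropTwo_lexProduct (S : Finset (Fin (n + 2) → K)) (S' : Finset (Fin (n + 2) → K')) :
    dropTwo (lexProduct S S') = lexProduct (dropTwo S) (dropTwo S') := by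
  ext x
  rw [mem_dropTwo, mem_lexProduct, mem_lexProduct, mem_dropTwo, mem_dropTwo]
  have h1 : (fun i => (ofLex ((Fin.cons 0 (Fin.cons 0 x : Fin (n + 1) → K ×ₗ K') :
      Fin (n + 2) → K ×ₗ K') i)).1) = Fin.cons 0 (Fin.cons 0 fun i => (ofLex (x i)).1) := by
    ext i
    exact Fin.cases rfl (fun i => Fin.cases rfl (fun i => rfl) i) i
  have h2 : (fun i => (ofLex ((Fin.cons 0 (Fin.cons 0 x : Fin (n + 1) → K ×ₗ K') :
      Fin (n + 2) → K ×ₗ K') i)).2) = Fin.cons 0 (Fin.cons 0 fun i => (ofLex (x i)).2) := by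
    ext i
    exact Fin.cases rfl (fun i => Fin.cases rfl (fun i => rfl) i) i
  rw [h1, h2]

end SignInvariant

/-! ### Jumps, shadows and forced signs -/

section Expansion

variable {K : Type*} [AddCommGroup K] [LinearOrder K] [IsOrderedAddMonoid K] {n : ℕ}

/-- A word `f`, read with positions `1, …, n`, and extended by `0` at all other positions. -/
def pad {α : Type*} [Zero α] (f : Fin n → α) (i : ℕ) : α :=
  if h : 1 ≤ i ∧ i ≤ n then f ⟨i - 1, by omega⟩ else 0

theorem pad_zero {α : Type*} [Zero α] (f : Fin n → α) : pad f 0 = 0 := by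
  simp [pad]

theorem pad_succ {α : Type*} [Zero α] (f : Fin n → α) {i : ℕ} (hi : i < n) :
    pad f (i + 1) = f ⟨i, hi⟩ := by
  rw [pad, dif_pos (by omega)]
  rfl

theorem letter_zero (w : Equiv.Perm (Fin n)) : letter w 0 = 0 :=
  pad_zero fun j => (w j : ℕ) + 1

theorem letter_succ (w : Equiv.Perm (Fin n)) {i : ℕ} (hi : i < n) :
    letter w (i + 1) = w ⟨i, hi⟩ + 1 :=
  pad_succ (fun j => (w j : ℕ) + 1) hi

theorem letter_succ_ne (w : Equiv.Perm (Fin n)) {i : ℕ} (hi : i < n) :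
    letter w i ≠ letter w (i + 1) := by
  rcases i with _ | i
  · rw [letter_zero, letter_succ w hi]
    omega
  · rw [letter_succ w hi, letter_succ w (by omega : i < n)]
    intro h
    have h' : w ⟨i, by omega⟩ = w ⟨i + 1, hi⟩ := Fin.ext (by omega)
    have := congrArg Fin.val (w.injective h')
    simp at this

/-- The positions `j ∈ {0, …, n - 1}` with `m_j < m_{j+1}`, where `m_0 = 0`. -/
def jumpSet (m : Fin n → K) : Finset ℕ :=
  {j ∈ Finset.range n | pad m j < pad m (j + 1)}

/-- The set of all `j` and `j + 1` for `j ∈ J`. -/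
def shadow (J : Finset ℕ) : Finset ℕ :=
  J ∪ J.image (· + 1)

theorem mem_shadow {J : Finset ℕ} {i : ℕ} : i ∈ shadow J ↔ i ∈ J ∨ ∃ j ∈ J, j + 1 = i := by
  simp [shadow]

theorem succ_mem_shadow {J : Finset ℕ} {i : ℕ} : i + 1 ∈ shadow J ↔ i + 1 ∈ J ∨ i ∈ J := by
  simp [shadow]

/-- The word `t`, placed along `w`, is sorted by `w` when the keys increase from each position to
the next. Position `0`, with letter and entry `0`, imposes no condition of its own and treats the
leading zeros of `t` like all other entries. -/
theorem signedSort_comp_symm_eq_iff (w : Equiv.Perm (Fin n)) (t : Fin n → K) :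
    signedSort (t ∘ w.symm) = w ↔
      ∀ a < n, signedKey (pad t a) (letter w a) < signedKey (pad t (a + 1)) (letter w (a + 1)) := by
  rw [signedSort_eq_iff]
  have hval : ∀ i : Fin n, (sortKey (t ∘ w.symm) ∘ w) i =
      signedKey (pad t (i + 1)) (letter w (i + 1)) := by
    intro i
    rw [pad_succ t i.2, letter_succ w i.2]
    simp [sortKey]
  constructor
  · intro h a ha
    rcases a with _ | a
    · rw [signedKey_lt_signedKey, pad_zero, letter_zero, letter_succ w ha]
      rcases (abs_nonneg (pad t (0 + 1))).lt_or_eq with h | h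
      · exact Or.inl (by simpa using h)
      · refine Or.inr ⟨by simpa using h, ?_⟩
        rw [abs_eq_zero.1 h.symm, if_neg (lt_irrefl _), if_neg (lt_irrefl _)]
        push_cast
        positivity
    · have := h (show (⟨a, by omega⟩ : Fin n) < ⟨a + 1, ha⟩ from Fin.lt_def.2 (by simp))
      rwa [hval, hval] at this
  · intro h i j hij
    rw [hval, hval]
    have chain : ∀ d (a : ℕ), a + d + 1 ≤ n → signedKey (pad t a) (letter w a) <
        signedKey (pad t (a + d + 1)) (letter w (a + d + 1)) := by
      intro d
      induction d with
      | zero => exact fun a ha => h a (by omega)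
      | succ d ih => exact fun a ha => (ih a (by omega)).trans (h _ (by omega))
    have hij' : (i : ℕ) < j := hij
    have := chain (j - i - 1) (i + 1) (by omega)
    rwa [show (i : ℕ) + 1 + (j - i - 1) + 1 = j + 1 by omega] at this

/-- Between letters `c ≠ d` at two positions where the absolute value of a signed vector is the
same, an ascent forces the second sign to be nonnegative, and a descent forces the first to be
negative. -/
theorem signedKey_lt_iff_of_abs_eq {y z : K} {c d : ℕ} (h : |y| = |z|) (hcd : c ≠ d) (hd : 0 < d) :
    signedKey y (c : ℤ) < signedKey z (d : ℤ) ↔ if c < d then ¬ z < 0 else y < 0 := by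
  rw [signedKey_lt_signedKey, h]
  by_cases hy : y < 0 <;> by_cases hz : z < 0 <;> simp only [hy, hz, if_true, if_false] <;>
    simp <;> omega

theorem signedSort_comp_symm_eq_iff_signs (w : Equiv.Perm (Fin n)) {m t : Fin n → K}
    (hm : Monotone m) (h0 : ∀ i, 0 ≤ m i) (ht : ∀ i, |t i| = m i) :
    signedSort (t ∘ w.symm) = w ↔
      ∀ b : Fin n,
        ((b : ℕ) ∉ jumpSet m → letter w b < letter w (b + 1) → ¬ t b < 0) ∧
        ((b : ℕ) + 1 < n → (b : ℕ) + 1 ∉ jumpSet m → letter w (b + 2) < letter w (b + 1) →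
          t b < 0) := by
  have habs : ∀ a, |pad t a| = pad m a := by
    intro a
    unfold pad
    split_ifs
    · exact ht _
    · exact abs_zero
  have hle : ∀ a < n, pad m a ≤ pad m (a + 1) := by
    intro a ha
    rcases a with _ | a
    · rw [pad_zero, pad_succ m ha]
      exact h0 _
    · rw [pad_succ m ha, pad_succ m (by omega : a < n)]
      exact hm (Fin.le_def.2 (by simp))
  have hstep : ∀ a < n,
      (signedKey (pad t a) (letter w a) < signedKey (pad t (a + 1)) (letter w (a + 1)) ↔
        (a ∉ jumpSet m →
          if letter w a < letter w (a + 1) then ¬ pad t (a + 1) < 0 else pad t a < 0)) := by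
    intro a ha
    by_cases hJ : a ∈ jumpSet m
    · simp only [hJ, not_true, false_imp_iff, iff_true]
      rw [signedKey_lt_signedKey, habs, habs]
      exact Or.inl (Finset.mem_filter.1 hJ).2
    · have heq : |pad t a| = |pad t (a + 1)| := by
        rw [habs, habs]
        refine (hle a ha).antisymm (le_of_not_gt fun hlt => hJ ?_)
        exact Finset.mem_filter.2 ⟨Finset.mem_range.2 ha, hlt⟩
      rw [signedKey_lt_iff_of_abs_eq heq (letter_succ_ne w ha) (by rw [letter_succ w ha]; omega)]
      simp only [hJ, not_false_iff, true_imp_iff]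
  rw [signedSort_comp_symm_eq_iff]
  constructor
  · intro h b
    refine ⟨fun hJ hlt => ?_, fun hb hJ hlt => ?_⟩
    · have := (hstep b b.2).1 (h b b.2) hJ
      rwa [if_pos hlt, pad_succ t b.2] at this
    · have := (hstep (b + 1) hb).1 (h _ hb) hJ
      rwa [if_neg hlt.not_gt, pad_succ t b.2] at this
  · intro h a ha
    rw [hstep a ha]
    intro hJ
    split_ifs with hlt
    · rw [pad_succ t ha]
      exact (h ⟨a, ha⟩).1 hJ hlt
    · have hgt := lt_of_le_of_ne (not_lt.1 hlt) (letter_succ_ne w ha).symm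
      rcases a with _ | a
      · rw [letter_zero] at hgt
        omega
      · rw [pad_succ t (by omega : a < n)]
        exact (h ⟨a, by omega⟩).2 ha hJ hgt

end Expansion

/-! ### Counting signs -/

section Expansion

variable {K : Type*} [AddCommGroup K] [LinearOrder K] [IsOrderedAddMonoid K] {n : ℕ}

theorem mem_peakSet_succ {w : Equiv.Perm (Fin n)} {b : ℕ} :
    b + 1 ∈ peakSet w ↔
      b + 1 < n ∧ letter w b < letter w (b + 1) ∧ letter w (b + 2) < letter w (b + 1) := by
  simp [peakSet]

/-- Sign `b` is forced by the ascent before it, for the sorting permutation to be `w`. -/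
def ForcedPos (w : Equiv.Perm (Fin n)) (J : Finset ℕ) (b : ℕ) : Prop :=
  b ∉ J ∧ letter w b < letter w (b + 1)

/-- Sign `b` is forced by the descent after it, for the sorting permutation to be `w`. -/
def ForcedNeg (w : Equiv.Perm (Fin n)) (J : Finset ℕ) (b : ℕ) : Prop :=
  b + 1 < n ∧ b + 1 ∉ J ∧ letter w (b + 2) < letter w (b + 1)

theorem peakSet_subset_shadow_iff (w : Equiv.Perm (Fin n)) (J : Finset ℕ) :
    peakSet w ⊆ shadow J ↔ ∀ b < n, ¬ (ForcedPos w J b ∧ ForcedNeg w J b) := by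
  constructor
  · rintro h b _ ⟨⟨hb, hlt⟩, hn, hb', hgt⟩
    have := succ_mem_shadow.1 (h (mem_peakSet_succ.2 ⟨hn, hlt, hgt⟩))
    tauto
  · intro h p hp
    obtain ⟨b, rfl⟩ : ∃ b, p = b + 1 := by
      have : 1 ≤ p := (Finset.mem_Ico.1 (Finset.mem_filter.1 hp).1).1
      exact ⟨p - 1, by omega⟩
    obtain ⟨hn, hlt, hgt⟩ := mem_peakSet_succ.1 hp
    rw [succ_mem_shadow]
    by_contra! hJ
    exact h b (by omega) ⟨⟨hJ.2, hlt⟩, hn, hJ.1, hgt⟩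

open Classical in
/-- Every `a ∉ J` forces exactly one sign, so `#J` signs are free. -/
theorem card_free_signs {w : Equiv.Perm (Fin n)} {J : Finset ℕ} (hJ : J ⊆ Finset.range n)
    (h : peakSet w ⊆ shadow J) :
    (Finset.range n |>.filter fun b => ¬ (ForcedPos w J b ∨ ForcedNeg w J b)).card = J.card := by
  have hforced : (Finset.range n \ J).card =
      ((Finset.range n).filter fun b => ForcedPos w J b ∨ ForcedNeg w J b).card := by
    -- `b` stands for the sign of the entry at position `b + 1`
    refine Finset.card_bij
      (fun a _ => if letter w a < letter w (a + 1) then a else a - 1) ?_ ?_ ?_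
    · intro a ha
      obtain ⟨ha, haJ⟩ := Finset.mem_sdiff.1 ha
      rw [Finset.mem_range] at ha
      rw [Finset.mem_filter, Finset.mem_range]
      split_ifs with hlt
      · exact ⟨ha, Or.inl ⟨haJ, hlt⟩⟩
      · have hgt := lt_of_le_of_ne (not_lt.1 hlt) (letter_succ_ne w ha).symm
        rcases a with _ | a
        · rw [letter_zero] at hgt
          omega
        · exact ⟨by omega, Or.inr ⟨ha, haJ, hgt⟩⟩
    · intro a ha a' ha' heq
      obtain ⟨ha, haJ⟩ := Finset.mem_sdiff.1 ha
      obtain ⟨ha', haJ'⟩ := Finset.mem_sdiff.1 ha'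
      rw [Finset.mem_range] at ha ha'
      rw [peakSet_subset_shadow_iff] at h
      have pos_of : ∀ a < n, ¬ letter w a < letter w (a + 1) →
          1 ≤ a ∧ letter w (a + 1) < letter w a := by
        intro a ha hlt
        have hgt := lt_of_le_of_ne (not_lt.1 hlt) (letter_succ_ne w ha).symm
        refine ⟨Nat.one_le_iff_ne_zero.2 ?_, hgt⟩
        rintro rfl
        rw [letter_zero] at hgt
        omega
      split_ifs at heq with h1 h2 h2
      · exact heq
      · obtain ⟨h3, h4⟩ := pos_of a' ha' h2
        obtain rfl : a' = a + 1 := by omega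
        exact absurd ⟨⟨haJ, h1⟩, ha', haJ', h4⟩ (h a ha)
      · obtain ⟨h3, h4⟩ := pos_of a ha h1
        obtain rfl : a = a' + 1 := by omega
        exact absurd ⟨⟨haJ', h2⟩, ha, haJ, h4⟩ (h a' ha')
      · have := (pos_of a ha h1).1
        have := (pos_of a' ha' h2).1
        omega
    · intro b hb
      obtain ⟨hb, hP | hN⟩ := Finset.mem_filter.1 hb
      · exact ⟨b, Finset.mem_sdiff.2 ⟨hb, hP.1⟩, if_pos hP.2⟩
      · exact ⟨b + 1, Finset.mem_sdiff.2 ⟨Finset.mem_range.2 hN.1, hN.2.1⟩,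
          if_neg hN.2.2.not_gt⟩
  have h1 := Finset.card_filter_add_card_filter_not (s := Finset.range n)
    (fun b => ForcedPos w J b ∨ ForcedNeg w J b)
  have h2 := Finset.card_sdiff_add_card_eq_card hJ
  omega

theorem jumpSet_subset_range (m : Fin n → K) : jumpSet m ⊆ Finset.range n :=
  Finset.filter_subset _ _

/-- The sign of a zero entry, which is no choice, counts as forced: an ascent precedes the entry, as
the first descent among the leading zeros of `m` would be a peak outside the shadow. -/
theorem forcedPos_of_eq_zero {w : Equiv.Perm (Fin n)} {m : Fin n → K} (hm : Monotone m)
    (h0 : ∀ i, 0 ≤ m i) (h : peakSet w ⊆ shadow (jumpSet m)) :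
    ∀ b (hb : b < n), m ⟨b, hb⟩ = 0 → ForcedPos w (jumpSet m) b := by
  intro b
  induction b with
  | zero =>
    intro hb hb0
    refine ⟨fun hJ => ?_, ?_⟩
    · have := (Finset.mem_filter.1 hJ).2
      rw [pad_zero, pad_succ m hb, hb0] at this
      exact this.false
    · rw [letter_zero, letter_succ w hb]
      omega
  | succ b ih =>
    intro hb hb0
    have hb1 : m ⟨b, by omega⟩ = 0 :=
      le_antisymm (hb0 ▸ hm (Fin.le_def.2 (by simp))) (h0 _)
    have hP := ih (by omega) hb1
    have hJ : b + 1 ∉ jumpSet m := fun hJ => by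
      have := (Finset.mem_filter.1 hJ).2
      rw [pad_succ m hb, pad_succ m (by omega : b < n), hb0, hb1] at this
      exact this.false
    refine ⟨hJ, not_le.1 fun hle => ?_⟩
    have hlt := lt_of_le_of_ne hle (letter_succ_ne w hb).symm
    exact (peakSet_subset_shadow_iff w _).1 h b (by omega) ⟨hP, hb, hJ, hlt⟩

/-- The number of ways to choose signs for the entries of a weakly increasing nonnegative vector
`m` so that the signed word, placed along `w`, has sorting permutation `w`. -/
theorem card_signs (w : Equiv.Perm (Fin n)) {m : Fin n → K} (hm : Monotone m)
    (h0 : ∀ i, 0 ≤ m i) :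
    ((Fintype.piFinset fun i => ({m i, -m i} : Finset K)).filter
      fun t => signedSort (t ∘ w.symm) = w).card =
      if peakSet w ⊆ shadow (jumpSet m) then 2 ^ (jumpSet m).card else 0 := by
  classical
  set J := jumpSet m with hJ
  have hset : ((Fintype.piFinset fun i => ({m i, -m i} : Finset K)).filter
      fun t => signedSort (t ∘ w.symm) = w) =
      Fintype.piFinset fun i : Fin n => ({m i, -m i} : Finset K).filter fun y =>
        (ForcedPos w J i → ¬ y < 0) ∧ (ForcedNeg w J i → y < 0) := by
    ext t
    simp only [Finset.mem_filter, Fintype.mem_piFinset]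
    rw [forall_and]
    refine and_congr_right fun ht => ?_
    have habs : ∀ i, |t i| = m i := fun i => (abs_eq (h0 i)).2 (by simpa using ht i)
    rw [signedSort_comp_symm_eq_iff_signs w hm h0 habs]
    simp only [ForcedPos, ForcedNeg, and_imp, hJ]
  rw [hset, Fintype.card_piFinset]
  split_ifs with h
  · have hcard : ∀ i : Fin n, (({m i, -m i} : Finset K).filter fun y =>
        (ForcedPos w J i → ¬ y < 0) ∧ (ForcedNeg w J i → y < 0)).card =
        if ForcedPos w J i ∨ ForcedNeg w J i then 1 else 2 := by
      intro i
      have hnot := (peakSet_subset_shadow_iff w J).1 h i i.2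
      rcases (h0 i).eq_or_lt with hi | hi
      · have hP : ForcedPos w J i := forcedPos_of_eq_zero hm h0 h i i.2 hi.symm
        have hN : ¬ ForcedNeg w J i := fun hN => hnot ⟨hP, hN⟩
        simp [← hi, hP, hN, Finset.filter_singleton]
      · have hne : m i ≠ -m i := fun he => by
          have := neg_lt_zero.2 hi
          rw [← he] at this
          exact lt_asymm hi this
        by_cases hP : ForcedPos w J i
        · have hN : ¬ ForcedNeg w J i := fun hN => hnot ⟨hP, hN⟩
          simp [hP, hN, Finset.filter_insert, Finset.filter_singleton, hi, hi.not_gt, -not_lt]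
        · by_cases hN : ForcedNeg w J i
          · simp [hP, hN, Finset.filter_insert, Finset.filter_singleton, hi, hi.not_gt]
          · simp [hP, hN, Finset.card_pair hne]
    rw [Finset.prod_congr rfl fun i _ => hcard i,
      ← Finset.prod_range fun b => if ForcedPos w J b ∨ ForcedNeg w J b then 1 else 2,
      Finset.prod_ite, Finset.prod_const_one, one_mul, Finset.prod_const,
      card_free_signs (jumpSet_subset_range m) h]
  · rw [peakSet_subset_shadow_iff] at h
    push Not at h
    obtain ⟨b, hb, hP, hN⟩ := h
    refine Finset.prod_eq_zero (Finset.mem_univ ⟨b, hb⟩) ?_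
    rw [Finset.card_eq_zero, Finset.filter_eq_empty_iff]
    exact fun y _ hy => hy.1 hP (hy.2 hN)

end Expansion

/-! ### Expansion of sorting sums in peak sums -/

section Expansion

variable {K : Type*} [AddCommGroup K] [LinearOrder K] [IsOrderedAddMonoid K] {n : ℕ}

theorem peakSet_mem_fibSets (w : Equiv.Perm (Fin n)) : peakSet w ∈ fibSets n := by
  refine Finset.mem_filter.2 ⟨Finset.mem_powerset.2 (Finset.filter_subset _ _), fun i hi hi' => ?_⟩
  have h1 := (Finset.mem_filter.1 hi).2.2
  have h2 := (Finset.mem_filter.1 hi').2.1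
  rw [Nat.add_sub_cancel] at h2
  exact lt_asymm h1 h2

/-- The sum of the `P_F` for `F ⊆ A`. -/
noncomputable def peakSumBelow (n : ℕ) (A : Finset ℕ) : SymGroupAlgebra n :=
  ∑ F ∈ fibSets n with F ⊆ A, peakSum n F

theorem peakSumBelow_eq_sum_perm (A : Finset ℕ) :
    peakSumBelow n A =
      ∑ w : Equiv.Perm (Fin n), if peakSet w ⊆ A then MonoidAlgebra.of ℚ _ w else 0 := by
  rw [← Finset.sum_filter, peakSumBelow]
  rw [← Finset.sum_fiberwise_of_maps_to (s := Finset.univ.filter fun w => peakSet w ⊆ A)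
    (t := (fibSets n).filter (· ⊆ A)) (g := peakSet)
    (fun w hw => Finset.mem_filter.2 ⟨peakSet_mem_fibSets w, (Finset.mem_filter.1 hw).2⟩)]
  refine Finset.sum_congr rfl fun F hF => ?_
  rw [peakSum, Finset.filter_filter]
  refine Finset.sum_congr (Finset.filter_congr fun w _ => ?_) fun _ _ => rfl
  exact ⟨fun h => ⟨h ▸ (Finset.mem_filter.1 hF).2, h⟩, fun h => h.2⟩

/-- The weakly increasing nonnegative members of `S`. -/
noncomputable def sortedPart (S : Finset (Fin n → K)) : Finset (Fin n → K) :=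
  open Classical in {m ∈ S | Monotone m ∧ ∀ i, 0 ≤ m i}

theorem mem_sortedPart {S : Finset (Fin n → K)} {m : Fin n → K} :
    m ∈ sortedPart S ↔ m ∈ S ∧ Monotone m ∧ ∀ i, 0 ≤ m i := by
  classical
  exact Finset.mem_filter

/-- The coefficient of `w` in `sortSum S`: the vectors sorted by `w` are the words `t ∘ w⁻¹`, and
the words `t` are grouped by their absolute values. -/
theorem card_signedSort_eq {S : Finset (Fin n → K)} (hS : SignInvariant S)
    (w : Equiv.Perm (Fin n)) :
    (S.filter fun x => signedSort x = w).card =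
      ∑ m ∈ sortedPart S, if peakSet w ⊆ shadow (jumpSet m) then 2 ^ (jumpSet m).card else 0 := by
  have h1 : (S.filter fun x => signedSort x = w).card =
      (S.filter fun t => signedSort (t ∘ w.symm) = w).card := by
    refine Finset.card_nbij' (fun x => x ∘ w) (fun t => t ∘ w.symm) ?_ ?_ ?_ ?_
    · intro x hx
      obtain ⟨hx, hw⟩ := Finset.mem_filter.1 hx
      refine Finset.mem_filter.2 ⟨hS x hx w _ fun i => rfl, ?_⟩
      rwa [Function.comp_assoc, Equiv.self_comp_symm, Function.comp_id]
    · intro t ht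
      obtain ⟨ht, hw⟩ := Finset.mem_filter.1 ht
      exact Finset.mem_filter.2 ⟨hS t ht w.symm _ fun i => rfl, hw⟩
    · intro x _
      simp [Function.comp_assoc]
    · intro t _
      simp [Function.comp_assoc]
  rw [h1, Finset.card_eq_sum_card_fiberwise (f := fun t i => |t i|) (t := sortedPart S)]
  · refine Finset.sum_congr rfl fun m hm => ?_
    obtain ⟨hmS, hmono, h0⟩ := mem_sortedPart.1 hm
    rw [← card_signs w hmono h0]
    congr 1
    ext t
    have habs : (∀ i, t i ∈ ({m i, -m i} : Finset K)) ↔ (fun i => |t i|) = m := by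
      rw [funext_iff]
      refine forall_congr' fun i => ?_
      rw [abs_eq (h0 i)]
      simp
    simp only [Finset.mem_filter, Fintype.mem_piFinset]
    rw [habs]
    constructor
    · exact fun h => ⟨h.2, h.1.2⟩
    · rintro ⟨rfl, hw⟩
      exact ⟨⟨hS _ hmS 1 t fun i => (abs_abs _).symm, hw⟩, rfl⟩
  · intro t ht
    obtain ⟨ht, hw⟩ := Finset.mem_filter.1 ht
    refine mem_sortedPart.2 ⟨hS t ht 1 _ fun i => abs_abs _, ?_, fun i => abs_nonneg _⟩
    have hmono := ((signedSort_eq_iff _ _).1 hw).monotone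
    intro i j hij
    have := Prod.Lex.monotone_fst _ _ (hmono hij)
    simpa [sortKey, signedKey] using this

/-- The sum of the sorting permutations of an invariant set, as a combination of peak sums; the
weakly increasing nonnegative members `m` of `S` represent the sign change and permutation classes
in `S`. -/
theorem sortSum_eq {S : Finset (Fin n → K)} (hS : SignInvariant S) :
    sortSum S = ∑ m ∈ sortedPart S,
      (2 : ℚ) ^ (jumpSet m).card • peakSumBelow n (shadow (jumpSet m)) := by
  have h1 : sortSum S = ∑ w : Equiv.Perm (Fin n),
      ((S.filter fun x => signedSort x = w).card : ℚ) • MonoidAlgebra.of ℚ _ w := by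
    rw [sortSum, ← Finset.sum_fiberwise_of_maps_to (t := Finset.univ) (g := signedSort)
      (fun _ _ => Finset.mem_univ _)]
    refine Finset.sum_congr rfl fun w _ => ?_
    rw [Finset.sum_congr rfl fun x hx => by rw [(Finset.mem_filter.1 hx).2], Finset.sum_const,
      Nat.cast_smul_eq_nsmul]
  simp_rw [h1, card_signedSort_eq hS, peakSumBelow_eq_sum_perm, Finset.smul_sum, Nat.cast_sum,
    Finset.sum_smul]
  rw [Finset.sum_comm]
  refine Finset.sum_congr rfl fun m _ => Finset.sum_congr rfl fun w _ => ?_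
  split_ifs <;> simp

/-- The vector with `i`-th entry, in positions `1, …, n`, the number of elements of `J`
below `i`. -/
def stepVector (n : ℕ) (J : Finset ℕ) (i : Fin n) : ℤ :=
  (J.filter (· ≤ (i : ℕ))).card

/-- The vectors obtained from `stepVector n J` by permuting coordinates and changing signs. -/
noncomputable def stepOrbit (n : ℕ) (J : Finset ℕ) : Finset (Fin n → ℤ) :=
    (Fintype.piFinset fun _ => Finset.Icc (-(J.card : ℤ)) J.card).filter fun x =>
    ∃ σ : Equiv.Perm (Fin n), ∀ i, |x i| = stepVector n J (σ i)

theorem mem_stepOrbit {J : Finset ℕ} {x : Fin n → ℤ} :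
    x ∈ stepOrbit n J ↔ ∃ σ : Equiv.Perm (Fin n), ∀ i, |x i| = stepVector n J (σ i) := by
  classical
  rw [stepOrbit, Finset.mem_filter, Fintype.mem_piFinset]
  refine and_iff_right_of_imp ?_
  rintro ⟨σ, h⟩ i
  rw [Finset.mem_Icc, ← abs_le, h]
  exact Nat.cast_le.2 (Finset.card_filter_le _ _)

theorem signInvariant_stepOrbit (J : Finset ℕ) : SignInvariant (stepOrbit n J) := by
  intro x hx σ t ht
  obtain ⟨τ, hτ⟩ := mem_stepOrbit.1 hx
  exact mem_stepOrbit.2 ⟨τ * σ, fun i => by rw [ht, hτ]; rfl⟩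

theorem stepVector_mono (J : Finset ℕ) : Monotone (stepVector n J) := by
  intro i j hij
  refine Nat.cast_le.2 (Finset.card_le_card (Finset.monotone_filter_right _ fun a _ h => ?_))
  exact le_trans h hij

theorem jumpSet_stepVector {J : Finset ℕ} (hJ : J ⊆ Finset.range n) :
    jumpSet (stepVector n J) = J := by
  ext j
  rw [jumpSet, Finset.mem_filter, Finset.mem_range]
  have hpad : ∀ i < n + 1, pad (stepVector n J) i = (J.filter (· < i)).card := by
    rintro (_ | i) hi
    · simp [pad_zero]
    · rw [pad_succ _ (by omega : i < n)]
      simp [stepVector]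
  constructor
  · rintro ⟨hj, h⟩
    by_contra hjJ
    rw [hpad _ (by omega), hpad _ (by omega)] at h
    refine h.ne (congrArg _ (congrArg _ (Finset.filter_congr fun i hi => ?_)))
    have : i ≠ j := fun h => hjJ (h ▸ hi)
    omega
  · intro hj
    have hjn := Finset.mem_range.1 (hJ hj)
    refine ⟨hjn, ?_⟩
    rw [hpad _ (by omega), hpad _ (by omega)]
    refine Nat.cast_lt.2 (Finset.card_lt_card ?_)
    refine Finset.ssubset_iff_subset_ne.2
      ⟨Finset.monotone_filter_right _ fun a _ h => ?_, fun h => ?_⟩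
    · exact Nat.lt_succ_of_lt h
    · have : j ∈ J.filter (· < j) := h ▸ Finset.mem_filter.2 ⟨hj, Nat.lt_succ_self j⟩
      exact lt_irrefl j (Finset.mem_filter.1 this).2

theorem sortedPart_stepOrbit (J : Finset ℕ) :
    sortedPart (stepOrbit n J) = {stepVector n J} := by
  ext m
  rw [mem_sortedPart, Finset.mem_singleton, mem_stepOrbit]
  constructor
  · rintro ⟨⟨σ, hσ⟩, hm, h0⟩
    have hm' : m = stepVector n J ∘ σ := by
      ext i
      rw [← abs_of_nonneg (h0 i), hσ]
      rfl
    rw [hm']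
    exact Tuple.unique_monotone (τ := 1) (hm' ▸ hm) (stepVector_mono J)
  · rintro rfl
    have h0 : ∀ i, 0 ≤ stepVector n J i := fun i => Nat.cast_nonneg _
    exact ⟨⟨1, fun i => abs_of_nonneg (h0 i)⟩, stepVector_mono J, h0⟩

theorem sortSum_stepOrbit {J : Finset ℕ} (hJ : J ⊆ Finset.range n) :
    sortSum (stepOrbit n J) = (2 : ℚ) ^ J.card • peakSumBelow n (shadow J) := by
  rw [sortSum_eq (signInvariant_stepOrbit J), sortedPart_stepOrbit, Finset.sum_singleton,
    jumpSet_stepVector hJ]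

end Expansion

/-! ### Sets without consecutive elements -/

section FibonacciSets

variable {n : ℕ}

theorem mem_fibSets {F : Finset ℕ} :
    F ∈ fibSets n ↔ (∀ i ∈ F, 1 ≤ i ∧ i < n) ∧ ∀ i ∈ F, i + 1 ∉ F := by
  simp [fibSets, Finset.subset_iff]

theorem subset_range_of_mem_fibSets {F : Finset ℕ} (hF : F ∈ fibSets n) : F ⊆ Finset.range n :=
  fun i hi => Finset.mem_range.2 ((mem_fibSets.1 hF).1 i hi).2

theorem subset_shadow (F : Finset ℕ) : F ⊆ shadow F :=
  Finset.subset_union_left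

/-- A set without consecutive elements in `F ∪ (F + 1)` picks at most one element from each of the
pairs `{i, i + 1}`, `i ∈ F`; hence its weight is smaller than that of `F`. -/
theorem weight_lt_of_subset_shadow {F G : Finset ℕ} (hF : F ∈ fibSets n) (hG : G ∈ fibSets n)
    (hsub : G ⊆ shadow F) (hne : G ≠ F) : ∑ i ∈ G, (n - i) < ∑ i ∈ F, (n - i) := by
  have hF' := mem_fibSets.1 hF
  have hG' := mem_fibSets.1 hG
  by_cases h : G ⊆ F
  · obtain ⟨i, hiF, hiG⟩ := Finset.exists_of_ssubset (h.ssubset_of_ne hne)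
    exact Finset.sum_lt_sum_of_subset h hiF hiG (Nat.sub_pos_of_lt (hF'.1 i hiF).2)
      fun _ _ _ => Nat.zero_le _
  · obtain ⟨j, hjG, hjF⟩ := Finset.not_subset.1 h
    -- send each element of `G` to the smaller element of the pair `{i, i + 1}`, `i ∈ F`, it lies in
    have hmaps : ∀ i ∈ G, (if i ∈ F then i else i - 1) ∈ F := by
      intro i hi
      split_ifs with hiF
      · exact hiF
      · rcases mem_shadow.1 (hsub hi) with h | ⟨k, hk, rfl⟩
        · exact absurd h hiF
        · simpa using hk
    have hinj : Set.InjOn (fun i => if i ∈ F then i else i - 1) G := by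
      intro i hi k hk hik
      have h1 := hG'.1 i hi
      have h2 := hG'.1 k hk
      dsimp only at hik
      split_ifs at hik with h3 h4 h4
      · exact hik
      · obtain rfl : k = i + 1 := by omega
        exact absurd hk (hG'.2 i hi)
      · obtain rfl : i = k + 1 := by omega
        exact absurd hi (hG'.2 k hk)
      · omega
    calc ∑ i ∈ G, (n - i) < ∑ i ∈ G, (n - if i ∈ F then i else i - 1) := by
          refine Finset.sum_lt_sum (fun i _ => ?_) ⟨j, hjG, ?_⟩
          · split_ifs <;> omega
          · have := hG'.1 j hjG
            rw [if_neg hjF]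
            omega
      _ = ∑ i ∈ G.image (fun i => if i ∈ F then i else i - 1), (n - i) :=
          (Finset.sum_image hinj).symm
      _ ≤ ∑ i ∈ F, (n - i) :=
          Finset.sum_le_sum_of_subset (Finset.image_subset_iff.2 hmaps)

theorem peakSumBelow_mem_peakSpace (A : Finset ℕ) : peakSumBelow n A ∈ peakSpace n :=
  Submodule.sum_mem _ fun F hF =>
    Submodule.subset_span ⟨F, (Finset.mem_filter.1 hF).1, rfl⟩

/-- The sums `peakSumBelow n (shadow J)` span the peak algebra, since they are unitriangular in the
`P_F` for `J ∈ fibSets n`. -/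
theorem peakSpace_eq_span_peakSumBelow :
    peakSpace n =
      Submodule.span ℚ ((fun J => peakSumBelow n (shadow J)) '' {J | J ⊆ Finset.range n}) := by
  refine le_antisymm (Submodule.span_le.2 ?_) (Submodule.span_le.2 ?_)
  · rintro _ ⟨F, hF, rfl⟩
    induction hk : ∑ i ∈ F, (n - i) using Nat.strong_induction_on generalizing F with
    | _ k ih =>
    subst hk
    have hF : F ∈ fibSets n := hF
    have hmem : F ∈ (fibSets n).filter (· ⊆ shadow F) :=
      Finset.mem_filter.2 ⟨hF, subset_shadow F⟩
    have hsum := Finset.add_sum_erase _ (peakSum n) hmem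
    rw [SetLike.mem_coe, eq_sub_of_add_eq hsum]
    refine Submodule.sub_mem _
      (Submodule.subset_span ⟨F, subset_range_of_mem_fibSets hF, rfl⟩)
      (Submodule.sum_mem _ fun G hG => ?_)
    obtain ⟨hGF, hG⟩ := Finset.mem_erase.1 hG
    obtain ⟨hG, hsub⟩ := Finset.mem_filter.1 hG
    exact ih _ (weight_lt_of_subset_shadow hF hG hsub hGF) G hG rfl
  · rintro _ ⟨J, _, rfl⟩
    exact peakSumBelow_mem_peakSpace _

/-- Every `F ∈ fibSets n` is a peak set: exchange the letters `i` and `i + 1` of the identity for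
all `i ∈ F`. -/
theorem exists_peakSet_eq {F : Finset ℕ} (hF : F ∈ fibSets n) :
    ∃ w : Equiv.Perm (Fin n), peakSet w = F := by
  obtain ⟨h1, h2⟩ := mem_fibSets.1 hF
  -- the index `i` stands for the position `i + 1`
  let f : Fin n → Fin n := fun i =>
    if h : (i : ℕ) + 1 ∈ F then ⟨i + 1, (h1 _ h).2⟩
    else if (i : ℕ) ∈ F then ⟨i - 1, by omega⟩ else i
  have hf : ∀ i, (f i : ℕ) =
      if (i : ℕ) + 1 ∈ F then (i : ℕ) + 1 else if (i : ℕ) ∈ F then (i : ℕ) - 1 else i := by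
    intro i
    dsimp only [f]
    split_ifs <;> rfl
  have hinv : Function.Involutive f := by
    intro i
    ext
    rw [hf, hf]
    have := h1 i
    have := h2 i
    have := h2 (i + 1)
    have := h2 (i - 1)
    grind
  have hlet : ∀ i < n, letter hinv.toPerm (i + 1) =
      if i + 1 ∈ F then i + 2 else if i ∈ F then i else i + 1 := by
    intro i hi
    rw [letter_succ _ hi, Function.Involutive.coe_toPerm, hf]
    have := h1 i
    grind
  refine ⟨hinv.toPerm, ?_⟩
  ext p
  rcases p with _ | b
  · refine iff_of_false (fun h => ?_) fun h => ?_
    · have := (Finset.mem_Ico.1 (Finset.mem_filter.1 h).1).1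
      omega
    · have := (h1 _ h).1
      omega
  · rw [mem_peakSet_succ]
    have hb1 := h1 (b + 1)
    have hb := h1 b
    have := h2 b
    have := h2 (b + 1)
    by_cases hn : b + 1 < n
    · rw [hlet b (by omega), hlet (b + 1) hn]
      rcases b with _ | b
      · rw [letter_zero]
        grind
      · rw [hlet b (by omega)]
        have := h2 b
        grind
    · grind

/-- The `P_F` can be mapped to arbitrary values by a linear map, as they are nonzero sums over
disjoint sets of permutations. -/
theorem exists_linearMap_peakSum {E : Type*} [AddCommGroup E] [Module ℚ E] (v : Finset ℕ → E) :
    ∃ L : SymGroupAlgebra n →ₗ[ℚ] E, ∀ F ∈ fibSets n, L (peakSum n F) = v F := by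
  classical
  choose! w hw using fun F (h : F ∈ fibSets n) => exists_peakSet_eq h
  refine ⟨{ toFun := fun x => ∑ G ∈ fibSets n, x.coeff (w G) • v G
            map_add' := fun x y => ?_
            map_smul' := fun c x => ?_ }, fun F hF => ?_⟩
  · rw [← Finset.sum_add_distrib]
    exact Finset.sum_congr rfl fun G _ => add_smul _ _ _
  · rw [RingHom.id_apply, Finset.smul_sum]
    exact Finset.sum_congr rfl fun G _ => mul_smul _ _ _
  · have hcoeff : ∀ G ∈ fibSets n, (peakSum n F).coeff (w G) = if G = F then 1 else 0 := by
      intro G hG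
      rw [peakSum, MonoidAlgebra.coeff_sum, Finsupp.finsetSum_apply]
      simp only [MonoidAlgebra.of_apply, MonoidAlgebra.coeff_single, Finsupp.single_apply]
      rw [Finset.sum_ite_eq' (Finset.univ.filter fun u => peakSet u = F) (w G)]
      simp [hw G hG]
    change ∑ G ∈ fibSets n, (peakSum n F).coeff (w G) • v G = v F
    rw [Finset.sum_congr rfl fun G hG => by rw [hcoeff G hG, ite_smul, one_smul, zero_smul],
      Finset.sum_ite_eq' (fibSets n) F, if_pos hF]

end FibonacciSets

/-! ### The projection dropping two letters -/

section Projection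

variable {n : ℕ}

/-- The shifted set `G + 2`. -/
def addTwo (G : Finset ℕ) : Finset ℕ :=
  G.image (· + 2)

theorem add_two_mem_addTwo {G : Finset ℕ} {i : ℕ} : i + 2 ∈ addTwo G ↔ i ∈ G := by
  simp [addTwo]

theorem one_notMem_addTwo {G : Finset ℕ} : 1 ∉ addTwo G := by
  simp [addTwo]

theorem zero_notMem_addTwo {G : Finset ℕ} : 0 ∉ addTwo G := by
  simp [addTwo]

theorem shiftTwo_addTwo (G : Finset ℕ) : shiftTwo (addTwo G) = G := by
  simp [shiftTwo, addTwo, Finset.image_image, Function.comp_def]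

theorem addTwo_shiftTwo {F : Finset ℕ} (hF : ∀ i ∈ F, 2 ≤ i) : addTwo (shiftTwo F) = F := by
  rw [shiftTwo, addTwo, Finset.image_image]
  conv_rhs => rw [← Finset.image_id (s := F)]
  refine Finset.image_congr fun i hi => ?_
  have := hF i hi
  simp only [Function.comp, id]
  omega

theorem shadow_addTwo (J : Finset ℕ) : shadow (addTwo J) = addTwo (shadow J) := by
  simp only [shadow, addTwo, Finset.image_union, Finset.image_image]
  rfl

theorem addTwo_subset_addTwo {F G : Finset ℕ} : addTwo F ⊆ addTwo G ↔ F ⊆ G :=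
  Finset.image_subset_image_iff (add_left_injective 2)

theorem addTwo_mem_fibSets {G : Finset ℕ} (hG : G ∈ fibSets n) : addTwo G ∈ fibSets (n + 2) := by
  rw [mem_fibSets] at hG ⊢
  have h : ∀ i ∈ addTwo G, 3 ≤ i ∧ i < n + 2 ∧ i - 2 ∈ G := by
    intro i hi
    obtain ⟨j, hj, rfl⟩ := Finset.mem_image.1 hi
    have := hG.1 j hj
    exact ⟨by omega, by omega, hj⟩
  refine ⟨fun i hi => ⟨by have := h i hi; omega, (h i hi).2.1⟩, fun i hi hi' => ?_⟩
  have := (h _ hi').2.2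
  obtain ⟨h3, -, hi⟩ := h i hi
  rw [show i + 1 - 2 = i - 2 + 1 by omega] at this
  exact hG.2 _ hi this

theorem two_notMem_addTwo {G : Finset ℕ} (hG : G ∈ fibSets n) : 2 ∉ addTwo G := fun h => by
  have := ((mem_fibSets.1 hG).1 0 (add_two_mem_addTwo.1 h)).1
  omega

/-- Members of `fibSets (n + 2)` without `1` and `2` are shifts of members of `fibSets n`. -/
theorem exists_addTwo_eq {F : Finset ℕ} (hF : F ∈ fibSets (n + 2)) (h1 : 1 ∉ F) (h2 : 2 ∉ F) :
    ∃ G ∈ fibSets n, addTwo G = F := by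
  obtain ⟨hF1, hF2⟩ := mem_fibSets.1 hF
  have h3 : ∀ i ∈ F, 3 ≤ i := by
    intro i hi
    have := (hF1 i hi).1
    have : i ≠ 1 := fun h => h1 (h ▸ hi)
    have : i ≠ 2 := fun h => h2 (h ▸ hi)
    omega
  have hF' := addTwo_shiftTwo fun i hi => (Nat.le_succ 2).trans (h3 i hi)
  refine ⟨shiftTwo F, mem_fibSets.2 ⟨fun i hi => ?_, fun i hi hi' => ?_⟩, hF'⟩
  · have hi := hF' ▸ add_two_mem_addTwo.2 hi
    have := h3 _ hi
    have := hF1 _ hi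
    omega
  · exact hF2 (i + 2) (hF' ▸ add_two_mem_addTwo.2 hi) (hF' ▸ add_two_mem_addTwo.2 hi')

theorem insert_one_mem_fibSets {F : Finset ℕ} (hF : F ∈ fibSets (n + 2)) (h2 : 2 ∉ F) :
    insert 1 F ∈ fibSets (n + 2) := by
  obtain ⟨h, h'⟩ := mem_fibSets.1 hF
  refine mem_fibSets.2 ⟨fun i hi => ?_, fun i hi hi' => ?_⟩
  · rcases Finset.mem_insert.1 hi with rfl | hi
    · omega
    · exact h i hi
  · rcases Finset.mem_insert.1 hi with rfl | hi
    · exact h2 (by simpa using hi')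
    · rcases Finset.mem_insert.1 hi' with hi' | hi'
      · have := (h i hi).1
        omega
      · exact h' i hi hi'

theorem erase_one_mem_fibSets {F : Finset ℕ} (hF : F ∈ fibSets n) : F.erase 1 ∈ fibSets n := by
  obtain ⟨h, h'⟩ := mem_fibSets.1 hF
  exact mem_fibSets.2 ⟨fun i hi => h i (Finset.mem_of_mem_erase hi), fun i hi hi' =>
    h' i (Finset.mem_of_mem_erase hi) (Finset.mem_of_mem_erase hi')⟩

theorem peakProjValue_addTwo {G : Finset ℕ} (hG : G ∈ fibSets n) :
    peakProjValue n (addTwo G) = peakSum n G := by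
  rw [peakProjValue, if_neg one_notMem_addTwo, if_neg (two_notMem_addTwo hG), shiftTwo_addTwo]

theorem peakProjValue_insert_addTwo (G : Finset ℕ) :
    peakProjValue n (insert 1 (addTwo G)) = -peakSum n G := by
  rw [peakProjValue, if_pos (Finset.mem_insert_self _ _),
    Finset.erase_insert one_notMem_addTwo, shiftTwo_addTwo]

theorem peakProjValue_of_two_mem {F : Finset ℕ} (h1 : 1 ∉ F) (h2 : 2 ∈ F) :
    peakProjValue n F = 0 := by
  rw [peakProjValue, if_neg h1, if_pos h2]

theorem two_notMem_of_one_mem {F : Finset ℕ} (hF : F ∈ fibSets n) (h1 : 1 ∈ F) : 2 ∉ F :=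
  (mem_fibSets.1 hF).2 1 h1

/-- A member of `fibSets (n + 2)` contains `2` and not `1`, or is a shift `G + 2`, or is of the form
`{1} ∪ (G + 2)`. -/
theorem fibSets_add_two_cases {F : Finset ℕ} (hF : F ∈ fibSets (n + 2)) :
    (1 ∉ F ∧ 2 ∈ F) ∨ (∃ G ∈ fibSets n, F = addTwo G) ∨
      ∃ G ∈ fibSets n, F = insert 1 (addTwo G) := by
  by_cases h1 : 1 ∈ F
  · have h2 := two_notMem_of_one_mem hF h1
    obtain ⟨G, hG, h⟩ := exists_addTwo_eq (erase_one_mem_fibSets hF) (Finset.notMem_erase 1 F)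
      (fun h => h2 (Finset.mem_of_mem_erase h))
    exact Or.inr (Or.inr ⟨G, hG, by rw [h, Finset.insert_erase h1]⟩)
  · by_cases h2 : 2 ∈ F
    · exact Or.inl ⟨h1, h2⟩
    · obtain ⟨G, hG, h⟩ := exists_addTwo_eq hF h1 h2
      exact Or.inr (Or.inl ⟨G, hG, h.symm⟩)

/-- The sum of the prescribed values at the `P_F` with `F ⊆ A`. -/
theorem sum_peakProjValue (A : Finset ℕ) :
    ∑ F ∈ fibSets (n + 2) with F ⊆ A, peakProjValue n F =
      if 1 ∈ A then 0 else ∑ G ∈ fibSets n with addTwo G ⊆ A, peakSum n G := by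
  have hinj : Function.Injective addTwo :=
    Finset.image_injective (add_left_injective 2)
  have hinj' : Function.Injective fun G => insert 1 (addTwo G) := fun G H h => by
    have h' := congrArg (fun F => F.erase 1) h
    dsimp only at h'
    rw [Finset.erase_insert one_notMem_addTwo, Finset.erase_insert one_notMem_addTwo] at h'
    exact hinj h'
  set s := (fibSets n).filter fun G => addTwo G ⊆ A with hs
  -- the terms with `1 ∈ F` are the negatives of those with `1, 2 ∉ F`
  have hone : ∑ F ∈ (fibSets (n + 2)).filter (· ⊆ A) with 1 ∈ F, peakProjValue n F =
      if 1 ∈ A then -∑ G ∈ s, peakSum n G else 0 := by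
    split_ifs with h1
    · rw [← Finset.sum_neg_distrib,
        ← Finset.sum_congr rfl fun G _ => peakProjValue_insert_addTwo G,
        ← Finset.sum_image (f := peakProjValue n) fun _ _ _ _ h => hinj' h]
      refine Finset.sum_congr (Finset.ext fun F => ?_) fun _ _ => rfl
      simp only [Finset.mem_filter, Finset.mem_image, hs]
      constructor
      · rintro ⟨⟨hF, hFA⟩, h1F⟩
        rcases fibSets_add_two_cases hF with h | ⟨G, hG, rfl⟩ | ⟨G, hG, rfl⟩
        · exact absurd h1F h.1
        · exact absurd h1F one_notMem_addTwo
        · exact ⟨G, ⟨hG, (Finset.subset_insert _ _).trans hFA⟩, rfl⟩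
      · rintro ⟨G, ⟨hG, hGA⟩, rfl⟩
        exact ⟨⟨insert_one_mem_fibSets (addTwo_mem_fibSets hG) (two_notMem_addTwo hG),
          Finset.insert_subset h1 hGA⟩, Finset.mem_insert_self _ _⟩
    · rw [Finset.filter_false_of_mem, Finset.sum_empty]
      exact fun F hF h => h1 ((Finset.mem_filter.1 hF).2 h)
  have hnotone : ∑ F ∈ (fibSets (n + 2)).filter (· ⊆ A) with ¬ 1 ∈ F, peakProjValue n F =
      ∑ G ∈ s, peakSum n G := by
    rw [Finset.sum_congr rfl fun G hG =>
        (peakProjValue_addTwo (Finset.mem_filter.1 hG).1).symm,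
      ← Finset.sum_image (f := peakProjValue n) fun _ _ _ _ h => hinj h]
    symm
    refine Finset.sum_subset (fun F hF => ?_) fun F hF hF' => ?_
    · obtain ⟨G, hG, rfl⟩ := Finset.mem_image.1 hF
      obtain ⟨hG, hGA⟩ := Finset.mem_filter.1 hG
      exact Finset.mem_filter.2 ⟨Finset.mem_filter.2 ⟨addTwo_mem_fibSets hG, hGA⟩,
        one_notMem_addTwo⟩
    · obtain ⟨hF, h1F⟩ := Finset.mem_filter.1 hF
      obtain ⟨hF, hFA⟩ := Finset.mem_filter.1 hF
      rcases fibSets_add_two_cases hF with h | ⟨G, hG, rfl⟩ | ⟨G, hG, rfl⟩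
      · exact peakProjValue_of_two_mem h.1 h.2
      · exact absurd (Finset.mem_image_of_mem _ (Finset.mem_filter.2 ⟨hG, hFA⟩)) hF'
      · exact absurd (Finset.mem_insert_self _ _) h1F
  rw [← Finset.sum_filter_add_sum_filter_not _ (1 ∈ ·), hone, hnotone]
  split_ifs
  · exact neg_add_cancel _
  · exact zero_add _

/-- `L` is the linear extension of the prescribed values `peakProjValue`. -/
def IsPeakProj (L : SymGroupAlgebra (n + 2) →ₗ[ℚ] SymGroupAlgebra n) : Prop :=
  ∀ F ∈ fibSets (n + 2), L (peakSum (n + 2) F) = peakProjValue n F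

variable {L : SymGroupAlgebra (n + 2) →ₗ[ℚ] SymGroupAlgebra n}

theorem IsPeakProj.map_peakSumBelow (hL : IsPeakProj L) (A : Finset ℕ) :
    L (peakSumBelow (n + 2) A) =
      if 1 ∈ A then 0 else ∑ G ∈ fibSets n with addTwo G ⊆ A, peakSum n G := by
  rw [← sum_peakProjValue, peakSumBelow, map_sum]
  exact Finset.sum_congr rfl fun F hF => hL F (Finset.mem_filter.1 hF).1

theorem IsPeakProj.map_peakSumBelow_shadow_of_mem (hL : IsPeakProj L) {J : Finset ℕ}
    (hJ : 0 ∈ J ∨ 1 ∈ J) : L (peakSumBelow (n + 2) (shadow J)) = 0 := by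
  rw [hL.map_peakSumBelow, if_pos (succ_mem_shadow.2 hJ.symm)]

theorem IsPeakProj.map_peakSumBelow_shadow_addTwo (hL : IsPeakProj L) (J : Finset ℕ) :
    L (peakSumBelow (n + 2) (shadow (addTwo J))) = peakSumBelow n (shadow J) := by
  rw [hL.map_peakSumBelow, shadow_addTwo, if_neg one_notMem_addTwo, peakSumBelow]
  simp only [addTwo_subset_addTwo]

section

variable {K K' : Type*} [AddCommGroup K] [LinearOrder K] [IsOrderedAddMonoid K]
  [AddCommGroup K'] [LinearOrder K'] [IsOrderedAddMonoid K']

theorem pad_cons_cons (m : Fin n → K) (i : ℕ) :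
    pad (Fin.cons 0 (Fin.cons 0 m : Fin (n + 1) → K) : Fin (n + 2) → K) (i + 2) = pad m i := by
  by_cases hi : i < n + 1
  · rw [pad_succ _ (by omega : i + 1 < n + 2)]
    rcases i with _ | i
    · rw [pad_zero]
      rfl
    · rw [pad_succ _ (by omega : i < n)]
      rfl
  · rw [pad, pad, dif_neg (by omega), dif_neg (by omega)]

theorem jumpSet_cons_cons (m : Fin n → K) :
    jumpSet (Fin.cons 0 (Fin.cons 0 m : Fin (n + 1) → K) : Fin (n + 2) → K) =
      addTwo (jumpSet m) := by
  ext j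
  rcases j with _ | _ | j
  · refine iff_of_false (fun h => ?_) zero_notMem_addTwo
    have := (Finset.mem_filter.1 h).2
    rw [pad_zero, pad_succ _ (by omega : 0 < n + 2)] at this
    exact lt_irrefl _ this
  · refine iff_of_false (fun h => ?_) one_notMem_addTwo
    have := (Finset.mem_filter.1 h).2
    rw [pad_succ _ (by omega : 0 < n + 2), pad_succ _ (by omega : 1 < n + 2)] at this
    exact lt_irrefl _ this
  · rw [add_two_mem_addTwo, jumpSet, jumpSet, Finset.mem_filter, Finset.mem_filter,
      pad_cons_cons, show j + 1 + 1 + 1 = j + 1 + 2 by omega, pad_cons_cons]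
    simp

theorem eq_cons_cons_of_notMem_jumpSet {m : Fin (n + 2) → K} (h0 : ∀ i, 0 ≤ m i)
    (hJ0 : 0 ∉ jumpSet m) (hJ1 : 1 ∉ jumpSet m) :
    ∃ m' : Fin n → K, m = Fin.cons 0 (Fin.cons 0 m' : Fin (n + 1) → K) := by
  have hm0 : m 0 = 0 := by
    refine le_antisymm (not_lt.1 fun h => hJ0 ?_) (h0 _)
    refine Finset.mem_filter.2 ⟨by simp, ?_⟩
    rw [pad_zero, pad_succ _ (by omega : 0 < n + 2)]
    exact h
  have hm1 : m 1 = 0 := by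
    refine le_antisymm (not_lt.1 fun h => hJ1 ?_) (h0 _)
    refine Finset.mem_filter.2 ⟨by simp, ?_⟩
    rw [pad_succ _ (by omega : 0 < n + 2), pad_succ _ (by omega : 1 < n + 2)]
    exact hm0.trans_lt h
  refine ⟨fun i => m i.succ.succ, funext fun i => ?_⟩
  exact Fin.cases hm0 (fun i => Fin.cases hm1 (fun i => rfl) i) i

theorem cons_cons_mem_sortedPart {S : Finset (Fin (n + 2) → K)} {m : Fin n → K} :
    (Fin.cons 0 (Fin.cons 0 m : Fin (n + 1) → K) : Fin (n + 2) → K) ∈ sortedPart S ↔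
      m ∈ sortedPart (dropTwo S) := by
  rw [mem_sortedPart, mem_sortedPart, mem_dropTwo]
  refine and_congr_right fun _ => ⟨fun ⟨h, h'⟩ => ⟨fun i j hij => ?_, fun i => ?_⟩,
    fun ⟨h, h'⟩ => ⟨fun i j => ?_, fun i => ?_⟩⟩
  · exact h (Fin.succ_le_succ_iff.2 (Fin.succ_le_succ_iff.2 hij))
  · exact h' i.succ.succ
  · refine Fin.cases (fun _ => ?_) (fun i => Fin.cases (fun _ => ?_) (fun i => ?_) i) i
    · exact Fin.cases le_rfl (fun j => Fin.cases le_rfl (fun j => h' j) j) j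
    · exact Fin.cases le_rfl (fun j => Fin.cases le_rfl (fun j => h' j) j) j
    · refine Fin.cases (fun hij => ?_) (fun j => Fin.cases (fun hij => ?_) (fun j hij => ?_) j) j
      · exact absurd hij (by simp)
      · exact absurd (Fin.succ_le_succ_iff.1 hij) (by simp)
      · exact h (Fin.succ_le_succ_iff.1 (Fin.succ_le_succ_iff.1 hij))
  · exact Fin.cases le_rfl (fun i => Fin.cases le_rfl (fun i => h' i) i) i

/-- On sums of sorting permutations, the projection keeps the vectors whose first two coordinates
vanish. -/
theorem IsPeakProj.map_sortSum (hL : IsPeakProj L) {S : Finset (Fin (n + 2) → K)}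
    (hS : SignInvariant S) : L (sortSum S) = sortSum (dropTwo S) := by
  classical
  rw [sortSum_eq hS, sortSum_eq hS.dropTwo, map_sum]
  have hinj : Function.Injective fun m : Fin n → K =>
      (Fin.cons 0 (Fin.cons 0 m : Fin (n + 1) → K) : Fin (n + 2) → K) := fun _ _ h =>
    Fin.cons_right_injective _ (Fin.cons_right_injective _ h)
  have hval : ∀ m : Fin n → K,
      (2 : ℚ) ^ (jumpSet m).card • peakSumBelow n (shadow (jumpSet m)) =
        L ((2 : ℚ) ^ (jumpSet (Fin.cons 0 (Fin.cons 0 m : Fin (n + 1) → K) :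
            Fin (n + 2) → K)).card •
          peakSumBelow (n + 2) (shadow (jumpSet (Fin.cons 0 (Fin.cons 0 m : Fin (n + 1) → K) :
            Fin (n + 2) → K)))) := by
    intro m
    rw [map_smul, jumpSet_cons_cons, hL.map_peakSumBelow_shadow_addTwo, addTwo,
      Finset.card_image_of_injective _ (add_left_injective 2)]
  rw [Finset.sum_congr rfl fun m _ => hval m,
    ← Finset.sum_image (f := fun m => L ((2 : ℚ) ^ (jumpSet m).card •
      peakSumBelow (n + 2) (shadow (jumpSet m)))) fun _ _ _ _ h => hinj h]
  symm
  refine Finset.sum_subset (fun m hm => ?_) fun m hm hm' => ?_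
  · obtain ⟨m', hm', rfl⟩ := Finset.mem_image.1 hm
    exact cons_cons_mem_sortedPart.2 hm'
  · rw [map_smul]
    by_cases hJ : 0 ∈ jumpSet m ∨ 1 ∈ jumpSet m
    · rw [hL.map_peakSumBelow_shadow_of_mem hJ, smul_zero]
    · rw [not_or] at hJ
      obtain ⟨m', rfl⟩ := eq_cons_cons_of_notMem_jumpSet (mem_sortedPart.1 hm).2.2 hJ.1 hJ.2
      exact absurd (Finset.mem_image_of_mem _ (cons_cons_mem_sortedPart.1 hm)) hm'

end

end Projection

/-! ### The peak algebra and the peak ideal -/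

section PeakAlgebra

variable {K : Type*} [AddCommGroup K] [LinearOrder K] [IsOrderedAddMonoid K] {n : ℕ}

theorem sortSum_mem_peakSpace {S : Finset (Fin n → K)} (hS : SignInvariant S) :
    sortSum S ∈ peakSpace n := by
  rw [sortSum_eq hS]
  exact Submodule.sum_mem _ fun m _ => Submodule.smul_mem _ _ (peakSumBelow_mem_peakSpace _)

/-- The orbit sums belonging to `J ⊆ {0, …, n - 1}` are nonzero multiples of the sums
`peakSumBelow n (shadow J)`; other sets `J` give no new elements. -/
theorem peakSpace_eq_span_sortSum :
    peakSpace n = Submodule.span ℚ {x | ∃ J, x = sortSum (stepOrbit n J)} := by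
  refine le_antisymm ?_ (Submodule.span_le.2 ?_)
  · rw [peakSpace_eq_span_peakSumBelow, Submodule.span_le]
    rintro _ ⟨J, hJ, rfl⟩
    have h := sortSum_stepOrbit (n := n) hJ
    have h' : peakSumBelow n (shadow J) = ((2 : ℚ) ^ J.card)⁻¹ • sortSum (stepOrbit n J) := by
      rw [h, inv_smul_smul₀ (by positivity)]
    dsimp only
    rw [h']
    exact Submodule.smul_mem _ _ (Submodule.subset_span ⟨J, rfl⟩)
  · rintro _ ⟨J, rfl⟩
    exact sortSum_mem_peakSpace (signInvariant_stepOrbit J)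

theorem one_mem_peakSpace : (1 : SymGroupAlgebra n) ∈ peakSpace n := by
  rw [← sortSum_singleton_zero (K := ℤ)]
  refine sortSum_mem_peakSpace fun x hx σ t ht => ?_
  rw [Finset.mem_singleton] at hx ⊢
  subst hx
  exact funext fun i => by simpa using ht i

theorem mul_mem_peakSpace (x y : SymGroupAlgebra n) (hx : x ∈ peakSpace n)
    (hy : y ∈ peakSpace n) : x * y ∈ peakSpace n := by
  rw [peakSpace_eq_span_sortSum] at hx hy
  induction hx, hy using Submodule.span_induction₂ with
  | mem_mem x y hx hy =>
    obtain ⟨J, rfl⟩ := hx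
    obtain ⟨J', rfl⟩ := hy
    rw [← sortSum_lexProduct (signInvariant_stepOrbit J')]
    exact sortSum_mem_peakSpace
      ((signInvariant_stepOrbit J').lexProduct (signInvariant_stepOrbit J))
  | zero_left y _ => rw [zero_mul]; exact zero_mem _
  | zero_right x _ => rw [mul_zero]; exact zero_mem _
  | add_left x y z _ _ _ h h' => rw [add_mul]; exact add_mem h h'
  | add_right x y z _ _ _ h h' => rw [mul_add]; exact add_mem h h'
  | smul_left r x y _ _ h => rw [smul_mul_assoc]; exact Submodule.smul_mem _ _ h
  | smul_right r x y _ _ h => rw [mul_smul_comm]; exact Submodule.smul_mem _ _ h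

/-- The peak algebra of `n` letters. -/
noncomputable def peakAlgebra (n : ℕ) : Subalgebra ℚ (SymGroupAlgebra n) :=
  (peakSpace n).toSubalgebra one_mem_peakSpace mul_mem_peakSpace

theorem peakSum_eq_zero {F : Finset ℕ} (hF : F ∉ fibSets n) : peakSum n F = 0 := by
  rw [peakSum, Finset.filter_false_of_mem, Finset.sum_empty]
  rintro w _ rfl
  exact hF (peakSet_mem_fibSets w)

theorem peakSum_mem_peakSpace (F : Finset ℕ) : peakSum n F ∈ peakSpace n := by
  by_cases hF : F ∈ fibSets n
  · exact Submodule.subset_span ⟨F, hF, rfl⟩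
  · rw [peakSum_eq_zero hF]
    exact zero_mem _

theorem interiorPeakSet_eq_erase (w : Equiv.Perm (Fin n)) :
    interiorPeakSet w = (peakSet w).erase 1 := by
  ext i
  simp only [interiorPeakSet, peakSet, Finset.mem_erase, Finset.mem_filter, Finset.mem_Ico]
  constructor
  · rintro ⟨⟨h, h'⟩, h''⟩
    exact ⟨by omega, ⟨by omega, h'⟩, h''⟩
  · rintro ⟨h1, ⟨h, h'⟩, h''⟩
    exact ⟨⟨by omega, h'⟩, h''⟩

theorem interiorPeakSum_eq {F : Finset ℕ} (h1 : 1 ∉ F) :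
    interiorPeakSum n F = peakSum n F + peakSum n (insert 1 F) := by
  classical
  rw [interiorPeakSum, peakSum, peakSum, ← Finset.sum_union]
  · refine Finset.sum_congr ?_ fun _ _ => rfl
    ext w
    simp only [Finset.mem_filter, Finset.mem_union, Finset.mem_univ, true_and]
    rw [interiorPeakSet_eq_erase]
    constructor
    · rintro rfl
      by_cases h : 1 ∈ peakSet w
      · exact Or.inr (Finset.insert_erase h).symm
      · exact Or.inl (Finset.erase_eq_of_notMem h).symm
    · rintro (h | h)
      · rw [h, Finset.erase_eq_of_notMem h1]
      · rw [h, Finset.erase_insert h1]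
  · refine Finset.disjoint_filter.2 fun w _ h h' => h1 ?_
    rw [← h, h']
    exact Finset.mem_insert_self _ _

theorem interiorPeakSum_of_two_mem {F : Finset ℕ} (h1 : 1 ∉ F) (h2 : 2 ∈ F) :
    interiorPeakSum n F = peakSum n F := by
  rw [interiorPeakSum_eq h1, peakSum_eq_zero (F := insert 1 F), add_zero]
  exact fun h => two_notMem_of_one_mem h (Finset.mem_insert_self _ _) (Finset.mem_insert_of_mem h2)

theorem interiorPeakSpace_le_peakSpace : interiorPeakSpace n ≤ peakSpace n := by
  refine Submodule.span_le.2 ?_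
  rintro _ ⟨F, hF, rfl⟩
  rw [interiorPeakSum_eq (Finset.mem_filter.1 hF).2]
  exact add_mem (peakSum_mem_peakSpace _) (peakSum_mem_peakSpace _)

theorem peakSpace_le_interiorPeakSpace (hn : n ≤ 1) : peakSpace n ≤ interiorPeakSpace n := by
  refine Submodule.span_le.2 ?_
  rintro _ ⟨F, hF, rfl⟩
  have h1 : ∀ G ∈ fibSets n, 1 ∉ G := fun G hG h => by
    have := (mem_fibSets.1 hG).1 1 h
    omega
  refine Submodule.subset_span ⟨F, Finset.mem_filter.2 ⟨hF, h1 F hF⟩, ?_⟩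
  rw [interiorPeakSum_eq (h1 F hF), peakSum_eq_zero (F := insert 1 F), add_zero]
  exact fun h => h1 _ h (Finset.mem_insert_self _ _)

section

variable {L : SymGroupAlgebra (n + 2) →ₗ[ℚ] SymGroupAlgebra n}

theorem IsPeakProj.map_mem_peakSpace (hL : IsPeakProj L) {x : SymGroupAlgebra (n + 2)}
    (hx : x ∈ peakSpace (n + 2)) : L x ∈ peakSpace n := by
  suffices peakSpace (n + 2) ≤ (peakSpace n).comap L from this hx
  refine Submodule.span_le.2 ?_
  rintro _ ⟨F, hF, rfl⟩
  change L _ ∈ peakSpace n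
  rw [hL F hF, peakProjValue]
  split_ifs
  · exact neg_mem (peakSum_mem_peakSpace _)
  · exact zero_mem _
  · exact peakSum_mem_peakSpace _

theorem IsPeakProj.map_one (hL : IsPeakProj L) : L 1 = 1 := by
  have hS : SignInvariant ({0} : Finset (Fin (n + 2) → ℤ)) := fun x hx σ t ht => by
    rw [Finset.mem_singleton] at hx ⊢
    subst hx
    exact funext fun i => by simpa using ht i
  rw [← sortSum_singleton_zero (K := ℤ), hL.map_sortSum hS, ← sortSum_singleton_zero (K := ℤ)]
  congr 1
  ext x
  rw [mem_dropTwo, Finset.mem_singleton, Finset.mem_singleton]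
  constructor
  · intro h
    exact funext fun i => congrFun h i.succ.succ
  · rintro rfl
    exact funext fun i => Fin.cases rfl (fun i => Fin.cases rfl (fun i => rfl) i) i

/-- Both passing to vectors vanishing in the first two coordinates and forming sorting sums respect
lexicographic products. -/
theorem IsPeakProj.map_mul (hL : IsPeakProj L) {x y : SymGroupAlgebra (n + 2)}
    (hx : x ∈ peakSpace (n + 2)) (hy : y ∈ peakSpace (n + 2)) : L (x * y) = L x * L y := by
  rw [peakSpace_eq_span_sortSum] at hx hy
  induction hx, hy using Submodule.span_induction₂ with
  | mem_mem x y hx hy =>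
    obtain ⟨J, rfl⟩ := hx
    obtain ⟨J', rfl⟩ := hy
    have hJ := signInvariant_stepOrbit (n := n + 2) J
    have hJ' := signInvariant_stepOrbit (n := n + 2) J'
    rw [← sortSum_lexProduct hJ', hL.map_sortSum (hJ'.lexProduct hJ), dropTwo_lexProduct,
      sortSum_lexProduct hJ'.dropTwo, hL.map_sortSum hJ, hL.map_sortSum hJ']
  | zero_left y _ => simp
  | zero_right x _ => simp
  | add_left x y z _ _ _ h h' => rw [add_mul, map_add, h, h', map_add, add_mul]
  | add_right x y z _ _ _ h h' => rw [mul_add, map_add, h, h', map_add, mul_add]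
  | smul_left r x y _ _ h => rw [smul_mul_assoc, map_smul, h, map_smul, smul_mul_assoc]
  | smul_right r x y _ _ h => rw [mul_smul_comm, map_smul, h, map_smul, mul_smul_comm]

theorem IsPeakProj.map_peakSum_addTwo (hL : IsPeakProj L) {G : Finset ℕ} (hG : G ∈ fibSets n) :
    L (peakSum (n + 2) (addTwo G)) = peakSum n G := by
  rw [hL _ (addTwo_mem_fibSets hG), peakProjValue_addTwo hG]

theorem IsPeakProj.map_peakSum_insert_addTwo (hL : IsPeakProj L) {G : Finset ℕ}
    (hG : G ∈ fibSets n) : L (peakSum (n + 2) (insert 1 (addTwo G))) = -peakSum n G := by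
  rw [hL _ (insert_one_mem_fibSets (addTwo_mem_fibSets hG) (two_notMem_addTwo hG)),
    peakProjValue_insert_addTwo]

theorem IsPeakProj.surjOn (hL : IsPeakProj L) {y : SymGroupAlgebra n} (hy : y ∈ peakSpace n) :
    ∃ x ∈ peakSpace (n + 2), L x = y := by
  suffices peakSpace n ≤ (peakSpace (n + 2)).map L from this hy
  refine Submodule.span_le.2 ?_
  rintro _ ⟨G, hG, rfl⟩
  exact ⟨_, peakSum_mem_peakSpace _, hL.map_peakSum_addTwo hG⟩

/-- The kernel of the projection on the peak algebra is the span of the interior peak sums: modulo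
these, every element of the peak algebra is a combination of the `P_{G + 2}`, on which the
projection is injective. -/
theorem IsPeakProj.map_eq_zero_iff (hL : IsPeakProj L) {x : SymGroupAlgebra (n + 2)}
    (hx : x ∈ peakSpace (n + 2)) : L x = 0 ↔ x ∈ interiorPeakSpace (n + 2) := by
  constructor
  · intro hx0
    -- `s` is a linear section of the projection; `x - s (L x)` is a combination of the `P°_F`
    obtain ⟨s, hs⟩ := exists_linearMap_peakSum (n := n) fun G => peakSum (n + 2) (addTwo G)
    suffices peakSpace (n + 2) ≤
        (interiorPeakSpace (n + 2)).comap (LinearMap.id - s.comp L) by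
      simpa [hx0] using this hx
    refine Submodule.span_le.2 ?_
    rintro _ ⟨F, hF, rfl⟩
    change peakSum (n + 2) F - s (L (peakSum (n + 2) F)) ∈ interiorPeakSpace (n + 2)
    rcases fibSets_add_two_cases hF with h | ⟨G, hG, rfl⟩ | ⟨G, hG, rfl⟩
    · rw [hL F hF, peakProjValue_of_two_mem h.1 h.2, map_zero, sub_zero,
        ← interiorPeakSum_of_two_mem h.1 h.2]
      exact Submodule.subset_span ⟨F, Finset.mem_filter.2 ⟨hF, h.1⟩, rfl⟩
    · rw [hL.map_peakSum_addTwo hG, hs G hG, sub_self]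
      exact zero_mem _
    · rw [hL.map_peakSum_insert_addTwo hG, map_neg, hs G hG, sub_neg_eq_add,
        add_comm (peakSum (n + 2) (insert 1 (addTwo G))),
        ← interiorPeakSum_eq one_notMem_addTwo]
      exact Submodule.subset_span
        ⟨_, Finset.mem_filter.2 ⟨addTwo_mem_fibSets hG, one_notMem_addTwo⟩, rfl⟩
  · intro hx
    suffices interiorPeakSpace (n + 2) ≤ LinearMap.ker L from this hx
    refine Submodule.span_le.2 ?_
    rintro _ ⟨F, hF, rfl⟩
    obtain ⟨hF, h1⟩ := Finset.mem_filter.1 hF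
    change L _ = 0
    rcases fibSets_add_two_cases hF with h | ⟨G, hG, rfl⟩ | ⟨G, hG, rfl⟩
    · rw [interiorPeakSum_of_two_mem h.1 h.2, hL F hF, peakProjValue_of_two_mem h.1 h.2]
    · rw [interiorPeakSum_eq h1, map_add, hL.map_peakSum_addTwo hG,
        hL.map_peakSum_insert_addTwo hG, add_neg_cancel]
    · exact absurd (Finset.mem_insert_self _ _) h1

end

theorem exists_peakProj (n : ℕ) :
    ∃ π : peakAlgebra (n + 2) →ₐ[ℚ] peakAlgebra n,
      (∀ F ∈ fibSets (n + 2), ∀ x : peakAlgebra (n + 2),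
        (x : SymGroupAlgebra (n + 2)) = peakSum (n + 2) F →
          (π x : SymGroupAlgebra n) = peakProjValue n F) ∧
      Function.Surjective π ∧
      ∀ x : peakAlgebra (n + 2),
        π x = 0 ↔ (x : SymGroupAlgebra (n + 2)) ∈ interiorPeakSpace (n + 2) := by
  obtain ⟨L, hL⟩ := exists_linearMap_peakSum (n := n + 2) (peakProjValue n)
  have hL : IsPeakProj L := hL
  let π : peakAlgebra (n + 2) →ₐ[ℚ] peakAlgebra n :=
    AlgHom.ofLinearMap
      (L.restrict (p := peakSpace (n + 2)) (q := peakSpace n) fun x hx => hL.map_mem_peakSpace hx)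
      (Subtype.ext hL.map_one) (fun x y => Subtype.ext (hL.map_mul x.2 y.2))
  have hπ : ∀ x, (π x : SymGroupAlgebra n) = L x := fun x => rfl
  refine ⟨π, fun F hF x hx => ?_, fun y => ?_, fun x => ?_⟩
  · rw [hπ, hx, hL F hF]
  · obtain ⟨x, hx, hxy⟩ := hL.surjOn y.2
    exact ⟨⟨x, hx⟩, Subtype.ext hxy⟩
  · rw [← hL.map_eq_zero_iff x.2, ← hπ]
    exact Subtype.ext_iff

/-- The span of the interior peak sums is a two-sided ideal: the kernel of the projection, or, for
`n ≤ 1`, the whole algebra. -/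
theorem exists_peakIdeal (n : ℕ) :
    ∃ I : Ideal (peakAlgebra n), I.IsTwoSided ∧
      ∀ x : peakAlgebra n, x ∈ I ↔ (x : SymGroupAlgebra n) ∈ interiorPeakSpace n := by
  rcases le_or_gt n 1 with hn | hn
  · exact ⟨⊤, inferInstance,
      fun x => iff_of_true Submodule.mem_top (peakSpace_le_interiorPeakSpace hn x.2)⟩
  · obtain ⟨k, rfl⟩ := Nat.exists_eq_add_of_le' hn
    obtain ⟨π, -, -, hπ⟩ := exists_peakProj k
    exact ⟨RingHom.ker π, inferInstance, fun x => RingHom.mem_ker.trans (hπ x)⟩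

end PeakAlgebra

theorem mainTheorem2 :
    ∃ P : ∀ n : ℕ, Subalgebra ℚ (SymGroupAlgebra n),
      (∀ n : ℕ, Subalgebra.toSubmodule (P n) = peakSpace n) ∧
      ∃ I : ∀ n : ℕ, Ideal (P n),
        (∀ n : ℕ, (Subtype.val : P n → SymGroupAlgebra n) '' (I n : Set (P n)) =
          (interiorPeakSpace n : Set (SymGroupAlgebra n))) ∧
        ∃ _ : ∀ n : ℕ, (I n).IsTwoSided,
          ∀ n : ℕ, ∃ π : P (n + 2) →ₐ[ℚ] P n,
            (∀ F ∈ fibSets (n + 2), ∀ x : P (n + 2), (x : SymGroupAlgebra (n + 2)) = peakSum (n + 2) F →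
              (π x : SymGroupAlgebra n) = peakProjValue n F) ∧
            Function.Surjective π ∧
            ∃ e : (P (n + 2) ⧸ I (n + 2)) ≃ₐ[ℚ] P n,
              ∀ x : P (n + 2), e (Ideal.Quotient.mk (I (n + 2)) x) = π x := by
  choose I hI hmem using exists_peakIdeal
  refine ⟨peakAlgebra, fun n => rfl, I, fun n => ?_, hI, fun n => ?_⟩
  · ext x
    constructor
    · rintro ⟨y, hy, rfl⟩
      exact (hmem n y).1 hy
    · exact fun hx => ⟨⟨x, interiorPeakSpace_le_peakSpace hx⟩, (hmem n _).2 hx, rfl⟩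
  · obtain ⟨π, hval, hsurj, hker⟩ := exists_peakProj n
    have hIker : I (n + 2) = RingHom.ker π :=
      Ideal.ext fun x => (hmem _ x).trans ((hker x).symm.trans RingHom.mem_ker.symm)
    exact ⟨π, hval, hsurj,
      (Ideal.quotientEquivAlgOfEq ℚ hIker).trans (Ideal.quotientKerAlgEquivOfSurjective hsurj),
      fun x => rfl⟩
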